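/- **Setting.** Let $\mathcal G$ be a directed graph on $\{1,\dots,N\}$ with adjacency entries $a_{ij}=1$ if $(i,j)$ is an edge ($i\ne j$) and $a_{ij}=0$ otherwise, and Laplacian $L=\operatorname{diag}(\sum_j a_{ij})-(a_{ij})$; put $\mathbf L=L\otimes I_d$. Let $r=N^{-1/2}\mathbf 1_N$ and let $R\in\mathbb R^{N\times(N-1)}$ satisfy $R^{\mathrm T}r=0$, $R^{\mathrm T}R=I_{N-1}$. Let $f_i:\mathbb R^d\times\mathbb R^l\to\mathbb R$ ($i=1,\dots,N$), $\zeta:\mathbb R\to\mathbb R^l$, let $x^*(t)$ be the minimizer of $\sum_i f_i(\cdot,\zeta(t))$ and $x_i^*(t)$ the minimizer of $f_i(\cdot,\zeta(t))$. Let $\alpha,\beta,\gamma,k,v,\omega_h>0$, $t_0\in\mathbb R$, and $\xi(t)=(1+\beta(t-t_0))^{1/v}$. Write $\nabla_xf_i$ for the gradient in the first variable, and put $\mathbf z^*_i(t)=-\tfrac12\alpha k\nabla_x f_i(x^*(t),\zeta(t))$. **Assumptions.** 1. Each $f_i$ is three times continuously differentiable and, for all $t\in\mathbb R$, $f_i(\cdot,\zeta(t))$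 is $m_i$-strongly convex with $m_i>0$ and $\nabla_xf_i(\cdot,\zeta(t))$ is $M_i$-Lipschitz. Put $m=\min_i m_i$, $M=\max_i M_i$. 2. $\zeta$ is twice differentiable, and there are $M_1,M_2\ge0$ and $c\in\mathbb R$ such that for all $t\ge t_0$: $\|\zeta(t)\|+\|x^*(t)\|+\sum_i\|x_i^*(t)\|\le M_1$ and $\|\dot\zeta(t)\|+\|\ddot\zeta(t)\|+\|\dot x^*(t)\|+\|\ddot x^*(t)\|\le M_2\,\xi^{c}(t)$. 3. $\mathcal G$ is weight-balanced (in-degree equals out-degree at each node) and strongly connected. **Averaged system.** For $\mathbf x=(x_1,\dots,x_N)\in(\mathbb R^d)^N$, $\eta\in\mathbb R^N$, $\mathbf z=(z_1,\dots,z_N)\in(\mathbb R^d)^N$, with $\bar x_i=\xi^{-1}(t)x_i+x^*(t)$, the system on $[t_0,\infty)$ is, for $i=1,\dots,N$, $$\dot x_i=\tfrac{\beta}{v}\xi^{-v}(t)x_i-\tfrac12\alpha k\nabla_xf_i(\bar x_i,\zeta(t))-(\mathbf L\mathbf x)_i-z_i-\mathbf z_i^*(t)-\xi(t)\dot x^*(t),$$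 $$\dot\eta_i=\big(\tfrac{\beta}{v}\xi^{-v}(t)-\omega_h\big)\eta_i+\omega_h\xi(t)\big(f_i(\bar x_i,\zeta(t))-f_i(x^*(t),\zeta(t))\big)-\xi(t)\tfrac{\mathrm d}{\mathrm dt}f_i(x^*(t),\zeta(t)),$$ $$\dot z_i=\gamma(\mathbf L\mathbf x)_i-\dot{\mathbf z}_i^*(t).$$ **Claim.** Suppose Assumptions 1–3 hold with $v\ge2$ and $c<-3$, and that there are matrices $P_2,P_3\in\mathbb R^{(N-1)\times(N-1)}$ with $P_3$ symmetric positive definite and scalars $p_{11},p_{22},\delta>0$ such that, with $A=R^{\mathrm T}LR$ and $\star$ denoting the transposed blocks, $$\begin{bmatrix}p_{22}I&P_2\\\star&P_3\end{bmatrix}>0,\qquad \Phi_1=\begin{bmatrix}\Phi_{11}&0&0\\0&\Phi_{12}&\frac{\beta}{v}P_2\\0&\star&-\frac12(P_2+P_2^{\mathrm T})\end{bmatrix}<0,$$ $$\Phi_2=\begin{bmatrix}\Phi_{21}&\Phi_{22}&\frac12(p_{22}-p_{11})\alpha k I\\\star&-\frac12(P_2+P_2^{\mathrm T})&-\frac12\alpha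 kP_2^{\mathrm T}\\\star&\star&-\delta I\end{bmatrix}<0,$$ where $\Phi_{11}=2\frac{\beta}{v}p_{11}-mp_{11}\alpha k+\delta M^2$, $\Phi_{12}=\big(2\frac{\beta}{v}p_{22}-mp_{11}\alpha k+\delta M^2\big)I$, $\Phi_{21}=-p_{22}(A+A^{\mathrm T})+\gamma P_2A+\gamma A^{\mathrm T}P_2^{\mathrm T}$ and $\Phi_{22}=-p_{22}I+\gamma A^{\mathrm T}P_3-A^{\mathrm T}P_2$. Then every solution $(\mathbf x,\eta,\mathbf z)$ of the averaged system on $[t_0,\infty)$ whose initial value lies in $\Omega(\mathbf 0_d)=\{(\mathbf x,\eta,\mathbf z):\sum_i z_i=\mathbf 0_d\}$ converges to the origin as $t\to\infty$. -/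

import Mathlib

open Matrix Filter Topology

noncomputable section

namespace TVOpt

/-- The Euclidean space `ℝ^d`. -/
abbrev Vec (d : ℕ) : Type := EuclideanSpace ℝ (Fin d)

/-- The concatenated space `(ℝ^d)^N`; only its (product) topology and linear structure are used. -/
abbrev Stack (N d : ℕ) : Type := Fin N → Vec d

/-! ### The communication graph -/

section Graph

variable {N : ℕ}

open Classical in
/-- The adjacency matrix: `a_ij = 1` if `(i, j)` is an edge and `0` otherwise, with `a_ii = 0`. -/
def adjacency (G : Digraph (Fin N)) : Matrix (Fin N) (Fin N) ℝ :=
  Matrix.of fun i j => if i ≠ j ∧ G.Adj i j then 1 else 0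

/-- The out-degree `∑_j a_ij`. -/
def outDegree (G : Digraph (Fin N)) (i : Fin N) : ℝ := ∑ j, adjacency G i j

/-- The in-degree `∑_j a_ji`. -/
def inDegree (G : Digraph (Fin N)) (i : Fin N) : ℝ := ∑ j, adjacency G j i

/-- The Laplacian `L = D_out - A`. -/
def laplacian (G : Digraph (Fin N)) : Matrix (Fin N) (Fin N) ℝ :=
  Matrix.diagonal (outDegree G) - adjacency G

/-- The graph is weight-balanced and strongly connected (every ordered pair of nodes is joined by
a directed path). -/
structure GraphAssumption (G : Digraph (Fin N)) : Prop where
  balanced : ∀ i, inDegree G i = outDegree G i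
  stronglyConnected : ∀ i j, Relation.ReflTransGen G.Adj i j

/-- The action of `𝐋 = L ⊗ I_d` on `(ℝ^d)^N`. -/
def lapAct {d : ℕ} (G : Digraph (Fin N)) (x : Stack N d) : Stack N d :=
  fun i => ∑ j, laplacian G i j • x j

/-- The unit vector `r = N^{-1/2} 1_N`. -/
def rVec (N : ℕ) : Fin N → ℝ := fun _ => 1 / Real.sqrt N

end Graph

/-! ### The optimization problem -/

section Problem

variable {N d l : ℕ}

/-- The gradient of `f_i(·, z)` at `x`. -/
def gradX (f : Fin N → Vec d → Vec l → ℝ) (i : Fin N) (x : Vec d) (z : Vec l) : Vec d :=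
  gradient (fun y => f i y z) x

/-- Smoothness, strong convexity and Lipschitz gradients of the local costs. -/
structure CostAssumption (f : Fin N → Vec d → Vec l → ℝ) (ζ : ℝ → Vec l)
    (mᵢ Mᵢ : Fin N → ℝ) : Prop where
  smooth : ∀ i, ContDiff ℝ 3 (fun p : Vec d × Vec l => f i p.1 p.2)
  pos : ∀ i, 0 < mᵢ i
  strongConvex : ∀ i t, StrongConvexOn Set.univ (mᵢ i) (fun x => f i x (ζ t))
  lipschitz : ∀ i t x y, ‖gradX f i x (ζ t) - gradX f i y (ζ t)‖ ≤ Mᵢ i * ‖x - y‖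

/-- `xs t` is the minimizer `x*(t)` of `∑ i, f_i(·, ζ(t))` (unique, by strong convexity). -/
def IsOptimum (f : Fin N → Vec d → Vec l → ℝ) (ζ : ℝ → Vec l) (xs : ℝ → Vec d) : Prop :=
  ∀ t, IsMinOn (fun x => ∑ i, f i x (ζ t)) Set.univ (xs t)

/-- `xloc i t` is the minimizer `x_i*(t)` of the local cost `f_i(·, ζ(t))`. -/
def IsLocalOptimum (f : Fin N → Vec d → Vec l → ℝ) (ζ : ℝ → Vec l)
    (xloc : Fin N → ℝ → Vec d) : Prop :=
  ∀ i t, IsMinOn (fun x => f i x (ζ t)) Set.univ (xloc i t)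

/-- `ζ` is twice differentiable, and `ζ`, `x*`, `x_i*` and the derivatives of `ζ` and `x*` obey the
stated bounds with growth function `φ` and power `c` from the initial time on. -/
structure GrowthAssumption (t₀ : ℝ) (φ : ℝ → ℝ) (c : ℝ) (ζ : ℝ → Vec l) (xs : ℝ → Vec d)
    (xloc : Fin N → ℝ → Vec d) : Prop where
  diff : Differentiable ℝ ζ
  diff₂ : Differentiable ℝ (deriv ζ)
  bound : ∃ M₁ : ℝ, 0 ≤ M₁ ∧ ∀ t, t₀ ≤ t →
    ‖ζ t‖ + ‖xs t‖ + ∑ i, ‖xloc i t‖ ≤ M₁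
  growth : ∃ M₂ : ℝ, 0 ≤ M₂ ∧ ∀ t, t₀ ≤ t →
    ‖deriv ζ t‖ + ‖deriv (deriv ζ) t‖ + ‖deriv xs t‖ + ‖deriv (deriv xs) t‖ ≤ M₂ * φ t ^ c

end Problem

/-! ### The averaged system -/

section System

variable {N d l : ℕ}

/-- The positive parameters `α, β, γ, k, v, ω_h` of the algorithm. -/
structure Params where
  α : ℝ
  β : ℝ
  γ : ℝ
  k : ℝ
  v : ℝ
  ωh : ℝ
  α_pos : 0 < α
  β_pos : 0 < β
  γ_pos : 0 < γ
  k_pos : 0 < k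
  v_pos : 0 < v
  ωh_pos : 0 < ωh

/-- `ξ(t) = (1 + β (t - t₀))^{1/v}`. -/
def xi (p : Params) (t₀ t : ℝ) : ℝ := (1 + p.β * (t - t₀)) ^ (1 / p.v)

/-- `z*(t) = -(αk/2) ∂G/∂x (1_N ⊗ x*(t), ζ(t))`. -/
def zStar (p : Params) (f : Fin N → Vec d → Vec l → ℝ) (ζ : ℝ → Vec l) (xs : ℝ → Vec d)
    (t : ℝ) : Stack N d :=
  fun i => -((1 / 2 * p.α * p.k) • gradX f i (xs t) (ζ t))

/-- `x̄ = ξ⁻¹(t) x̄_f + 1_N ⊗ x*(t)`. -/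
def xBar (p : Params) (t₀ : ℝ) (xs : ℝ → Vec d) (x : Stack N d) (t : ℝ) : Stack N d :=
  fun i => (xi p t₀ t)⁻¹ • x i + xs t

/-- `h_f(x̄_f, ζ(t)) = h(x̄, ζ(t)) - h(1_N ⊗ x*(t), ζ(t))`. -/
def hf (p : Params) (t₀ : ℝ) (f : Fin N → Vec d → Vec l → ℝ) (ζ : ℝ → Vec l)
    (xs : ℝ → Vec d) (x : Stack N d) (t : ℝ) : Fin N → ℝ :=
  fun i => f i (xBar p t₀ xs x t i) (ζ t) - f i (xs t) (ζ t)

/-- The `x̄_f`-component of the right-hand side. -/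
def rhsX (p : Params) (t₀ : ℝ) (G : Digraph (Fin N)) (f : Fin N → Vec d → Vec l → ℝ)
    (ζ : ℝ → Vec l) (xs : ℝ → Vec d) (t : ℝ) (x z : Stack N d) : Stack N d :=
  fun i => (p.β / p.v * xi p t₀ t ^ (-p.v)) • x i
    - (1 / 2 * p.α * p.k) • gradX f i (xBar p t₀ xs x t i) (ζ t)
    + (-lapAct G x i - z i - zStar p f ζ xs t i)
    - xi p t₀ t • deriv xs t

/-- The `η̄_f`-component of the right-hand side. -/
def rhsEta (p : Params) (t₀ : ℝ) (f : Fin N → Vec d → Vec l → ℝ)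
    (ζ : ℝ → Vec l) (xs : ℝ → Vec d) (t : ℝ) (x : Stack N d) (η : Fin N → ℝ) : Fin N → ℝ :=
  fun i => (p.β / p.v * xi p t₀ t ^ (-p.v) - p.ωh) * η i
    + p.ωh * xi p t₀ t * hf p t₀ f ζ xs x t i
    - xi p t₀ t * deriv (fun s => f i (xs s) (ζ s)) t

/-- The `z̄_f`-component of the right-hand side. -/
def rhsZ (p : Params) (G : Digraph (Fin N)) (f : Fin N → Vec d → Vec l → ℝ)
    (ζ : ℝ → Vec l) (xs : ℝ → Vec d) (t : ℝ) (x : Stack N d) : Stack N d :=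
  fun i => p.γ • lapAct G x i - deriv (fun s => zStar p f ζ xs s i) t

/-- `(x̄_f, η̄_f, z̄_f)` solves the Lie bracket averaged system on `[t₀, ∞)`. -/
structure IsAveragedSolution (p : Params) (t₀ : ℝ) (G : Digraph (Fin N))
    (f : Fin N → Vec d → Vec l → ℝ) (ζ : ℝ → Vec l) (xs : ℝ → Vec d)
    (x : ℝ → Stack N d) (η : ℝ → Fin N → ℝ) (z : ℝ → Stack N d) : Prop where
  x_eq : ∀ t, t₀ ≤ t →
    HasDerivWithinAt x (rhsX p t₀ G f ζ xs t (x t) (z t)) (Set.Ici t₀) t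
  eta_eq : ∀ t, t₀ ≤ t →
    HasDerivWithinAt η (rhsEta p t₀ f ζ xs t (x t) (η t)) (Set.Ici t₀) t
  z_eq : ∀ t, t₀ ≤ t →
    HasDerivWithinAt z (rhsZ p G f ζ xs t (x t)) (Set.Ici t₀) t

/-- The set `Ω(ε)` of all `(x, η, z)` with `(1_N ⊗ I_d)ᵀ z = ε`. -/
def Omega (N : ℕ) {d : ℕ} (ε : Vec d) : Set (Stack N d × (Fin N → ℝ) × Stack N d) :=
  {s | ∑ i, s.2.2 i = ε}

end System

/-! ### The linear matrix inequalities -/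

section LMI

variable {n : Type*} [Fintype n] [DecidableEq n]

/-- `[p₂₂ I, P₂; P₂ᵀ, P₃]`. -/
def lyapBlock (p₂₂ : ℝ) (P₂ P₃ : Matrix n n ℝ) : Matrix (n ⊕ n) (n ⊕ n) ℝ :=
  fromBlocks (p₂₂ • 1) P₂ P₂ᵀ P₃

/-- The block-diagonal matrix `Φ₁`. -/
def Phi1 (p : Params) (m M p₁₁ p₂₂ δ : ℝ) (P₂ : Matrix n n ℝ) :
    Matrix (Unit ⊕ (n ⊕ n)) (Unit ⊕ (n ⊕ n)) ℝ :=
  fromBlocks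
    ((2 * (p.β / p.v) * p₁₁ - m * p₁₁ * p.α * p.k + δ * M ^ 2) • 1) 0 0
    (fromBlocks
      ((2 * (p.β / p.v) * p₂₂ - m * p₁₁ * p.α * p.k + δ * M ^ 2) • 1) ((p.β / p.v) • P₂)
      ((p.β / p.v) • P₂)ᵀ (-((1 / 2 : ℝ) • (P₂ + P₂ᵀ))))

/-- The block `Φ₂₁`, where `A` stands for `Rᵀ L R`. -/
def Phi21 (p : Params) (p₂₂ : ℝ) (A P₂ : Matrix n n ℝ) : Matrix n n ℝ :=
  -(p₂₂ • A) - p₂₂ • Aᵀ + p.γ • (P₂ * A) + p.γ • (Aᵀ * P₂ᵀ)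

/-- The block `Φ₂₂`, where `A` stands for `Rᵀ L R`: half the matrix of the `u`-`w` cross terms
`-2 p₂₂ uᵀ w + 2 γ wᵀ P₃ A u - 2 wᵀ P₂ᵀ A u`, written with `u` on the left. -/
def Phi22 (p : Params) (p₂₂ : ℝ) (A P₂ P₃ : Matrix n n ℝ) : Matrix n n ℝ :=
  -(p₂₂ • 1) + p.γ • (Aᵀ * P₃) - Aᵀ * P₂

/-- The matrix `Φ₂`, a symmetric `3 × 3` block matrix. -/
def Phi2 (p : Params) (p₁₁ p₂₂ δ : ℝ) (A P₂ P₃ : Matrix n n ℝ) :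
    Matrix ((n ⊕ n) ⊕ n) ((n ⊕ n) ⊕ n) ℝ :=
  fromBlocks
    (fromBlocks
      (Phi21 p p₂₂ A P₂) (Phi22 p p₂₂ A P₂ P₃)
      (Phi22 p p₂₂ A P₂ P₃)ᵀ (-((1 / 2 : ℝ) • (P₂ + P₂ᵀ))))
    (fromRows ((1 / 2 * (p₂₂ - p₁₁) * p.α * p.k) • 1) (-((1 / 2 * p.α * p.k) • P₂ᵀ)))
    (fromRows ((1 / 2 * (p₂₂ - p₁₁) * p.α * p.k) • 1) (-((1 / 2 * p.α * p.k) • P₂ᵀ)))ᵀ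
    (-(δ • 1))

/-- The matrix is (symmetric) negative definite. -/
def NegDef {ι : Type*} [Fintype ι] (Q : Matrix ι ι ℝ) : Prop := (-Q).PosDef

end LMI

end TVOpt

end

/-! The proof separates a fast disagreement from a slow damping. Put `q = ξ⁻¹` and `n = (Rᵀx, Rᵀz)`.
Weight balance gives `L = R B Rᵀ` with `B = RᵀLR`, and `∑ z_i = 0` is preserved, so `z` is recovered
from `n`. Then `n' = F n` up to errors of size `q‖x‖ + r` with `r = ξ^(1+c)`, where `F` is a
constant matrix. The leading blocks of `Φ₂` make `[p₂₂ I, P₂; P₂ᵀ, P₃]` a Lyapunov matrix `Q` for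
`F` (`posDef_lyapunov`).

In the energy `‖x‖²`, the Laplacian and `z` terms involve only `n` and cost `O(‖n‖²)`. The
gradients, evaluated at distance `ξ⁻¹‖x_i‖` from `x*`, contribute damping `-a m q‖x‖²` by strong
monotonicity. For small `ε` the function `V = ε‖x‖² + ⟨n, Q n⟩` therefore satisfies `V' ≤ -κ' q V +
K r²/q` (`tendsto_zero_of_slow_fast`). Since `v > 1`, `∫ q = ∞`; since `c < -2`, `r = o(q)`; a
comparison argument (`tendsto_zero_of_deriv_le`) gives `V → 0`. The term `(β/v) ξ^(-v) x` is
`O(q²‖x‖)` because `v ≥ 2`, hence harmless.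

Finally `η` solves a stable scalar equation whose input vanishes (`tendsto_eta`). Differentiability
of `x*` is not assumed; it follows from strong monotonicity (`differentiableAt_zero_of_strongMono`).
-/

noncomputable section

namespace TVOpt

/-! ### A comparison principle -/

section Comparison

/-- If `V' ≤ -A' V + b` with `A → ∞` and `b = o(A')`, then the nonnegative function `V` tends to
zero. -/
lemma tendsto_zero_of_deriv_le {V V' A a b : ℝ → ℝ}
    (hV : ∀ᶠ t in atTop, HasDerivAt V (V' t) t) (hV0 : ∀ᶠ t in atTop, 0 ≤ V t)
    (hA : ∀ᶠ t in atTop, HasDerivAt A (a t) t) (hAtop : Tendsto A atTop atTop)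
    (hle : ∀ᶠ t in atTop, V' t ≤ -a t * V t + b t)
    (hb : ∀ ε > 0, ∀ᶠ t in atTop, b t ≤ ε * a t) :
    Tendsto V atTop (𝓝 0) := by
  have key : ∀ ε > 0, ∀ᶠ t in atTop, V t < 2 * ε := by
    intro ε hε
    obtain ⟨T, hT⟩ := eventually_atTop.1 (((hV.and hA).and hle).and (hb ε hε))
    have hder : ∀ t, T ≤ t → HasDerivAt (fun t => Real.exp (A t) * (V t - ε))
        (Real.exp (A t) * a t * (V t - ε) + Real.exp (A t) * V' t) t := fun t ht =>
      ((hT t ht).1.1.2.exp).mul ((hT t ht).1.1.1.sub_const ε)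
    -- The derivative is `exp A * (a (V - ε) + V')`, at most `exp A * (b - ε a) ≤ 0`.
    have hanti : AntitoneOn (fun t => Real.exp (A t) * (V t - ε)) (Set.Ici T) := by
      refine antitoneOn_of_hasDerivWithinAt_nonpos (convex_Ici T)
        (fun t ht => (hder t ht).continuousAt.continuousWithinAt)
        (fun t ht => (hder t (interior_subset ht)).hasDerivWithinAt) fun t ht => ?_
      obtain ⟨⟨_, h1⟩, h2⟩ := hT t (interior_subset ht)
      have h3 : a t * (V t - ε) + V' t ≤ 0 := by linarith
      have := mul_nonpos_of_nonneg_of_nonpos (Real.exp_pos (A t)).le h3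
      linarith
    have hlim : Tendsto (fun t => Real.exp (-A t) * (Real.exp (A T) * (V T - ε))) atTop (𝓝 0) := by
      have := (Real.tendsto_exp_neg_atTop_nhds_zero.comp hAtop).mul_const
        (Real.exp (A T) * (V T - ε))
      simpa using this
    filter_upwards [hlim.eventually (gt_mem_nhds hε), eventually_ge_atTop T] with t h1 h2
    have h3 : Real.exp (A t) * (V t - ε) ≤ Real.exp (A T) * (V T - ε) :=
      hanti (Set.mem_Ici.2 le_rfl) h2 h2
    have h4 := mul_le_mul_of_nonneg_left h3 (Real.exp_pos (-A t)).le
    rw [← mul_assoc, ← Real.exp_add] at h4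
    simp only [neg_add_cancel, Real.exp_zero, one_mul] at h4
    linarith
  rw [Metric.tendsto_atTop']
  intro ε hε
  obtain ⟨T, hT⟩ := eventually_atTop.1 ((key (ε / 2) (by positivity)).and hV0)
  refine ⟨T, fun t ht => ?_⟩
  obtain ⟨h1, h2⟩ := hT t ht.le
  rw [Real.dist_eq, sub_zero, abs_of_nonneg h2]
  linarith

end Comparison

/-! ### Matrices acting on tuples of vectors -/

section Act

variable {ι κ μ V : Type*} [Fintype ι] [Fintype κ] [Fintype μ]
  [NormedAddCommGroup V] [InnerProductSpace ℝ V] [FiniteDimensional ℝ V]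

/-- The action of `Q ⊗ I` on tuples of vectors of `V`, with the Euclidean norm on tuples. -/
def act (V : Type*) [NormedAddCommGroup V] [InnerProductSpace ℝ V] [FiniteDimensional ℝ V]
    (Q : Matrix κ ι ℝ) : PiLp 2 (fun _ : ι => V) →L[ℝ] PiLp 2 (fun _ : κ => V) :=
  LinearMap.toContinuousLinearMap
    { toFun := fun u => WithLp.toLp 2 fun i => ∑ j, Q i j • u j
      map_add' := fun u v => by
        ext i : 1
        simp [Finset.sum_add_distrib]
      map_smul' := fun r u => by
        ext i : 1
        simp [Finset.smul_sum, smul_comm r] }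

@[simp] lemma act_apply (Q : Matrix κ ι ℝ) (u : PiLp 2 (fun _ : ι => V)) (i : κ) :
    act V Q u i = ∑ j, Q i j • u j := rfl

lemma act_mul (P : Matrix μ κ ℝ) (Q : Matrix κ ι ℝ) (u : PiLp 2 (fun _ : ι => V)) :
    act V (P * Q) u = act V P (act V Q u) := by
  ext i : 1
  simp only [act_apply, Matrix.mul_apply, Finset.sum_smul, Finset.smul_sum, smul_smul]
  exact Finset.sum_comm

lemma act_add (P Q : Matrix κ ι ℝ) (u : PiLp 2 (fun _ : ι => V)) :
    act V (P + Q) u = act V P u + act V Q u := by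
  ext i : 1
  simp [add_smul, Finset.sum_add_distrib]

lemma act_smul (r : ℝ) (Q : Matrix κ ι ℝ) (u : PiLp 2 (fun _ : ι => V)) :
    act V (r • Q) u = r • act V Q u := by
  ext i : 1
  simp [smul_smul, Finset.smul_sum]

lemma act_neg (Q : Matrix κ ι ℝ) (u : PiLp 2 (fun _ : ι => V)) : act V (-Q) u = -act V Q u := by
  simpa using act_smul (-1) Q u

lemma inner_act (Q : Matrix κ ι ℝ) (u : PiLp 2 (fun _ : ι => V)) (v : PiLp 2 (fun _ : κ => V)) :
    inner ℝ (act V Q u) v = inner ℝ u (act V Qᵀ v) := by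
  simp only [PiLp.inner_apply, act_apply, sum_inner, inner_sum, inner_smul_left, inner_smul_right,
    Matrix.transpose_apply, RCLike.conj_to_real]
  exact Finset.sum_comm

/-- Coordinates in an orthonormal basis of `V` decouple `Q ⊗ I` into one copy of `Q` per basis
direction, so definiteness of `Q` carries over to tuples. -/
lemma inner_act_eq_sum {σ : Type*} [Fintype σ] (b : OrthonormalBasis σ ℝ V) (Q : Matrix ι ι ℝ)
    (u : PiLp 2 (fun _ : ι => V)) :
    inner ℝ u (act V Q u) =
      ∑ c, (fun i => inner ℝ (b c) (u i)) ⬝ᵥ (Q *ᵥ fun i => inner ℝ (b c) (u i)) := by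
  simp only [PiLp.inner_apply, act_apply, dotProduct, mulVec]
  rw [Finset.sum_comm]
  refine Finset.sum_congr rfl fun i _ => ?_
  rw [← b.sum_inner_mul_inner]
  refine Finset.sum_congr rfl fun c _ => ?_
  rw [real_inner_comm, inner_sum]
  simp [inner_smul_right]

lemma inner_act_pos {Q : Matrix ι ι ℝ} (hQ : Q.PosDef) {u : PiLp 2 (fun _ : ι => V)}
    (hu : u ≠ 0) : 0 < inner ℝ u (act V Q u) := by
  set b := stdOrthonormalBasis ℝ V
  rw [inner_act_eq_sum b]
  have hnn : ∀ w : ι → ℝ, 0 ≤ w ⬝ᵥ (Q *ᵥ w) := fun w => by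
    simpa using hQ.posSemidef.dotProduct_mulVec_nonneg w
  obtain ⟨i, c, hic⟩ : ∃ i c, inner ℝ (b c) (u i) ≠ 0 := by
    by_contra! h
    refine hu (PiLp.ext fun i => ?_)
    rw [← b.sum_repr' (u i)]
    simp [h]
  refine Finset.sum_pos' (fun c _ => hnn _) ⟨c, Finset.mem_univ _, ?_⟩
  have := hQ.dotProduct_mulVec_pos (x := fun i => inner ℝ (b c) (u i))
    (fun h => hic (congrFun h i))
  simpa using this

/-- A positive quadratic form on a finite-dimensional space is coercive. -/
lemma exists_coercive {E : Type*} [NormedAddCommGroup E] [InnerProductSpace ℝ E]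
    [FiniteDimensional ℝ E] (T : E →L[ℝ] E) (hT : ∀ u, u ≠ 0 → 0 < inner ℝ u (T u)) :
    ∃ κ > 0, ∀ u, κ * ‖u‖ ^ 2 ≤ inner ℝ u (T u) := by
  have hcont : Continuous fun u : E => inner ℝ u (T u) := continuous_id.inner T.continuous
  -- The unit sphere is empty in the zero space, which does occur: for `N = 1` there are no
  -- disagreement coordinates.
  rcases (Metric.sphere (0 : E) 1).eq_empty_or_nonempty with hE | hne
  · refine ⟨1, one_pos, fun u => ?_⟩
    have hu : u = 0 := by
      by_contra hu
      have : ‖u‖⁻¹ • u ∈ Metric.sphere (0 : E) 1 := by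
        simp [norm_smul, hu]
      simp [hE] at this
    simp [hu]
  · obtain ⟨w, hw, hmin⟩ := (isCompact_sphere (0 : E) 1).exists_isMinOn hne hcont.continuousOn
    have hw1 : ‖w‖ = 1 := by simpa using hw
    refine ⟨inner ℝ w (T w), hT w (fun h => by simp [h] at hw1), fun u => ?_⟩
    by_cases hu : u = 0
    · simp [hu]
    have hu' : ‖u‖ ≠ 0 := norm_ne_zero_iff.2 hu
    have h1 : ‖u‖⁻¹ • u ∈ Metric.sphere (0 : E) 1 := by simp [norm_smul, hu]
    have h2 : inner ℝ w (T w) ≤ inner ℝ (‖u‖⁻¹ • u) (T (‖u‖⁻¹ • u)) := hmin h1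
    rw [map_smul, inner_smul_left, inner_smul_right] at h2
    simp only [RCLike.conj_to_real] at h2
    calc inner ℝ w (T w) * ‖u‖ ^ 2 ≤ (‖u‖⁻¹ * (‖u‖⁻¹ * inner ℝ u (T u))) * ‖u‖ ^ 2 := by gcongr
      _ = inner ℝ u (T u) := by field_simp

lemma exists_inner_act_ge (V : Type*) [NormedAddCommGroup V] [InnerProductSpace ℝ V]
    [FiniteDimensional ℝ V] {Q : Matrix ι ι ℝ} (hQ : Q.PosDef) :
    ∃ κ > 0, ∀ u : PiLp 2 (fun _ : ι => V), κ * ‖u‖ ^ 2 ≤ inner ℝ u (act V Q u) :=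
  exists_coercive _ fun _ hu => inner_act_pos hQ hu

end Act

/-! ### Strongly monotone gradients and the optimal trajectory -/

section Trajectory

lemma mul_norm_le_of_strongMono {V : Type*} [NormedAddCommGroup V] [InnerProductSpace ℝ V] {m : ℝ}
    {a v : V} (h : m * ‖v‖ ^ 2 ≤ inner ℝ a v) :
    m * ‖v‖ ≤ ‖a‖ := by
  rcases (norm_nonneg v).eq_or_lt with h0 | h0
  · rw [← h0]
    simp
  · have := h.trans (real_inner_le_norm a v)
    nlinarith

variable {V W U : Type*} [NormedAddCommGroup V] [InnerProductSpace ℝ V] [FiniteDimensional ℝ V]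
  [NormedAddCommGroup W] [NormedSpace ℝ W]
  [NormedAddCommGroup U] [NormedSpace ℝ U]

/-- The gradient of a strongly convex function is strongly monotone. -/
lemma le_inner_gradient_sub {g : V → ℝ} {m : ℝ} (hg : Differentiable ℝ g)
    (hs : StrongConvexOn Set.univ m g) (x y : V) :
    m * ‖x - y‖ ^ 2 ≤ inner ℝ (gradient g x - gradient g y) (x - y) := by
  -- Along the segment from `y` to `x`, `g - (m/2)‖·‖²` is a convex function of one variable: its
  -- derivative at `0` is at most its slope on `[0, 1]`, which is at most its derivative at `1`.
  have hφ := (strongConvexOn_iff_convex.1 hs).comp_affineMap (AffineMap.lineMap y x)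
  rw [Set.preimage_univ] at hφ
  have hder : ∀ s : ℝ, HasDerivAt
      ((fun u => g u - m / 2 * ‖u‖ ^ 2) ∘ AffineMap.lineMap y x)
      (inner ℝ (gradient g (AffineMap.lineMap y x s)) (x - y)
        - m / 2 * (2 * inner ℝ (AffineMap.lineMap y x s) (x - y))) s := by
    intro s
    have hl : HasDerivAt (AffineMap.lineMap y x : ℝ → V) (x - y) s := by
      simpa using (AffineMap.lineMap y x : ℝ →ᵃ[ℝ] V).hasDerivAt
    have h1 := (hg (AffineMap.lineMap y x s)).hasGradientAt.hasFDerivAt.comp_hasDerivAt s hl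
    have h2 := (hl.norm_sq).const_mul (m / 2)
    exact (h1.sub h2).congr_deriv (by simp)
  have h0 := hφ.le_slope_of_hasDerivAt (Set.mem_univ 0) (Set.mem_univ 1) one_pos (hder 0)
  have h1 := hφ.slope_le_of_hasDerivAt (Set.mem_univ 0) (Set.mem_univ 1) one_pos (hder 1)
  have h := h0.trans h1
  simp only [AffineMap.lineMap_apply_zero, AffineMap.lineMap_apply_one] at h
  have e : ‖x - y‖ ^ 2 = inner ℝ x (x - y) - inner ℝ y (x - y) := by
    rw [← inner_sub_left, real_inner_self_eq_norm_sq]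
  rw [inner_sub_left, e]
  linarith

/-- The zero of a strongly monotone map depends differentiably on the parameter. -/
lemma differentiableAt_zero_of_strongMono {F : V × W → V} {ζ : ℝ → W} {xs : ℝ → V} {m t : ℝ}
    (hm : 0 < m) (hF : Differentiable ℝ F)
    (hmono : ∀ s x y, m * ‖x - y‖ ^ 2 ≤ inner ℝ (F (x, ζ s) - F (y, ζ s)) (x - y))
    (hzero : ∀ s, F (xs s, ζ s) = 0) (hζ : DifferentiableAt ℝ ζ t) :
    DifferentiableAt ℝ xs t := by
  have hlow : ∀ s x y, m * ‖x - y‖ ≤ ‖F (x, ζ s) - F (y, ζ s)‖ := fun s x y =>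
    mul_norm_le_of_strongMono (hmono s x y)
  -- `F (xs t, ζ s)` differs from `F (xs s, ζ s) = 0` by at least `m ‖xs s - xs t‖`, and it is
  -- differentiable in `s` and vanishes at `s = t`.
  have hbig : (fun s => xs s - xs t) =O[𝓝 t] fun s => s - t := by
    have hρ : DifferentiableAt ℝ (fun s => F (xs t, ζ s)) t :=
      (hF _).comp t ((differentiableAt_const _).prodMk hζ)
    refine Asymptotics.IsBigO.trans (Asymptotics.IsBigO.of_bound m⁻¹ (Eventually.of_forall
      fun s => ?_)) hρ.isBigO_sub
    have := hlow s (xs s) (xs t)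
    rw [hzero, zero_sub, norm_neg] at this
    rw [hzero, sub_zero, inv_mul_eq_div, le_div_iff₀ hm]
    linarith
  have hcont : Tendsto xs (𝓝 t) (𝓝 (xs t)) := by
    have h0 : Tendsto (fun s => s - t) (𝓝 t) (𝓝 0) := by
      have : Continuous fun s : ℝ => s - t := by fun_prop
      simpa using this.tendsto t
    have := (hbig.trans_tendsto h0).add_const (xs t)
    simpa using this
  set F' := fderiv ℝ F (xs t, ζ t)
  have hF' : HasFDerivAt F F' (xs t, ζ t) := (hF _).hasFDerivAt
  -- `F` vanishes at both points of the curve, so its linearisation there is only the first-order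
  -- remainder.
  have hlit : (fun s => F' (xs s - xs t, ζ s - ζ t)) =o[𝓝 t] fun s => s - t := by
    have h1 := hF'.isLittleO.comp_tendsto (hcont.prodMk_nhds hζ.continuousAt)
    have h2 := h1.trans_isBigO (hbig.prod_left hζ.isBigO_sub)
    refine h2.neg_left.congr_left fun s => ?_
    simp only [Function.comp_apply, hzero, Prod.mk_sub_mk, sub_self, zero_sub, neg_neg]
  set H : V →L[ℝ] V := F'.comp (ContinuousLinearMap.inl ℝ V W)
  -- The lower bound `m` passes to the limit of difference quotients; in finite dimension it makes
  -- the partial derivative `H` bijective.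
  have hHlow : ∀ v, m * ‖v‖ ≤ ‖H v‖ := by
    intro v
    have hl : HasDerivAt (fun s : ℝ => (xs t + s • v, ζ t)) (v, (0 : W)) 0 := by
      have := ((hasDerivAt_id (0 : ℝ)).smul_const v).const_add (xs t)
      simpa using this.prodMk (hasDerivAt_const (0 : ℝ) (ζ t))
    have hFl : HasDerivAt (fun s : ℝ => F (xs t + s • v, ζ t)) (H v) 0 := by
      have h0 : HasFDerivAt F F' (xs t + (0 : ℝ) • v, ζ t) := by simpa using hF'
      exact h0.comp_hasDerivAt (0 : ℝ) hl
    refine ge_of_tendsto (hasDerivAt_iff_tendsto_slope_zero.1 hFl).norm ?_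
    filter_upwards [self_mem_nhdsWithin] with s hs
    have hs' : 0 < |s| := abs_pos.2 hs
    have := hlow t (xs t + s • v) (xs t)
    rw [add_sub_cancel_left, norm_smul, Real.norm_eq_abs] at this
    rw [norm_smul, norm_inv, Real.norm_eq_abs, inv_mul_eq_div, le_div_iff₀ hs']
    simp only [zero_add, zero_smul, add_zero]
    linarith
  have hinj : Function.Injective H := by
    refine (injective_iff_map_eq_zero H).2 fun v hv => ?_
    have := hHlow v
    rw [hv, norm_zero] at this
    exact norm_le_zero_iff.1 (by nlinarith [norm_nonneg v])
  -- The candidate derivative solves the linearised equation `H v₀ + F' (0, ζ') = 0`.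
  obtain ⟨v₀, hv₀⟩ := LinearMap.surjective_of_injective (f := (H : V →ₗ[ℝ] V)) hinj
    (-F' (0, deriv ζ t))
  have hv₀' : H v₀ = -F' (0, deriv ζ t) := hv₀
  have hHlit : (fun s => H (xs s - xs t - (s - t) • v₀)) =o[𝓝 t] fun s => s - t := by
    have h1 := (hasDerivAt_iff_isLittleO.1 hζ.hasDerivAt)
    have h2 := ((F'.comp (ContinuousLinearMap.inr ℝ V W)).isBigO_comp
      (fun s => ζ s - ζ t - (s - t) • deriv ζ t) (𝓝 t)).trans_isLittleO h1
    refine (hlit.sub h2).congr_left fun s => ?_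
    rw [map_sub H, map_smul H, hv₀', ContinuousLinearMap.comp_apply,
      ContinuousLinearMap.inr_apply, ContinuousLinearMap.comp_apply,
      ContinuousLinearMap.inl_apply, smul_neg, ← map_smul, sub_neg_eq_add, ← map_sub, ← map_add]
    congr 1
    ext <;> simp
  suffices HasDerivAt xs v₀ t from this.differentiableAt
  rw [hasDerivAt_iff_isLittleO]
  refine Asymptotics.IsBigO.trans_isLittleO (Asymptotics.IsBigO.of_bound m⁻¹
    (Eventually.of_forall fun s => ?_)) hHlit
  rw [inv_mul_eq_div, le_div_iff₀ hm]
  linarith [hHlow (xs s - xs t - (s - t) • v₀)]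

variable [FiniteDimensional ℝ W]

/-- The trajectory `(x*, ζ)` is bounded, so compactness of a ball supplies constants uniform in
time. -/
lemma exists_norm_fderiv_le {g : V × W → U} (hg : ContDiff ℝ 1 g) (ρ : ℝ) :
    ∃ C, 0 ≤ C ∧ ∀ p ∈ Metric.closedBall (0 : V × W) ρ, ‖fderiv ℝ g p‖ ≤ C := by
  obtain ⟨C, hC⟩ := (isCompact_closedBall (0 : V × W) ρ).exists_bound_of_continuousOn
    (hg.continuous_fderiv one_ne_zero).continuousOn
  exact ⟨max C 0, le_max_right _ _, fun p hp => (hC p hp).trans (le_max_left _ _)⟩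

lemma exists_norm_deriv_comp_le {g : V × W → U} (hg : ContDiff ℝ 1 g) {xs : ℝ → V} {ζ : ℝ → W}
    {t₀ ρ : ℝ} (hxs : Differentiable ℝ xs) (hζ : Differentiable ℝ ζ)
    (hb : ∀ t, t₀ ≤ t → ‖xs t‖ ≤ ρ ∧ ‖ζ t‖ ≤ ρ) :
    ∃ C, 0 ≤ C ∧ ∀ t, t₀ ≤ t →
      ‖deriv (fun s => g (xs s, ζ s)) t‖ ≤ C * (‖deriv xs t‖ + ‖deriv ζ t‖) := by
  obtain ⟨C, hC0, hC⟩ := exists_norm_fderiv_le hg ρ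
  refine ⟨C, hC0, fun t ht => ?_⟩
  have h1 : HasDerivAt (fun s => g (xs s, ζ s))
      (fderiv ℝ g (xs t, ζ t) (deriv xs t, deriv ζ t)) t :=
    ((hg.differentiable one_ne_zero) (xs t, ζ t)).hasFDerivAt.comp_hasDerivAt t
      ((hxs t).hasDerivAt.prodMk (hζ t).hasDerivAt)
  rw [h1.deriv]
  have hmem : (xs t, ζ t) ∈ Metric.closedBall (0 : V × W) ρ := by
    rw [mem_closedBall_zero_iff, Prod.norm_def]
    exact max_le (hb t ht).1 (hb t ht).2
  refine ((fderiv ℝ g (xs t, ζ t)).le_opNorm _).trans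
    (mul_le_mul (hC _ hmem) ?_ (norm_nonneg _) hC0)
  rw [Prod.norm_def]
  exact max_le (le_add_of_nonneg_right (norm_nonneg _)) (le_add_of_nonneg_left (norm_nonneg _))

lemma exists_lipschitz_fst {g : V × W → U} (hg : ContDiff ℝ 1 g) (ρ : ℝ) :
    ∃ C, 0 ≤ C ∧ ∀ x y w, ‖x‖ ≤ ρ → ‖y‖ ≤ ρ → ‖w‖ ≤ ρ →
      ‖g (x, w) - g (y, w)‖ ≤ C * ‖x - y‖ := by
  obtain ⟨C, hC0, hC⟩ := exists_norm_fderiv_le hg ρ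
  refine ⟨C, hC0, fun x y w hx hy hw => ?_⟩
  have hmem : ∀ x, ‖x‖ ≤ ρ → (x, w) ∈ Metric.closedBall (0 : V × W) ρ := fun x hx => by
    rw [mem_closedBall_zero_iff, Prod.norm_def]
    exact max_le hx hw
  have h := (convex_closedBall (0 : V × W) ρ).norm_image_sub_le_of_norm_fderiv_le
    (fun p _ => (hg.differentiable one_ne_zero) p) hC (hmem y hy) (hmem x hx)
  have e : ‖((x, w) : V × W) - (y, w)‖ = ‖x - y‖ := by
    rw [Prod.mk_sub_mk, sub_self, Prod.norm_mk, norm_zero, max_eq_left (norm_nonneg _)]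
  rwa [e] at h

end Trajectory

/-! ### The local cost functions -/

section Cost

variable {N d l : ℕ} {f : Fin N → Vec d → Vec l → ℝ} {ζ : ℝ → Vec l} {mᵢ Mᵢ : Fin N → ℝ}
  {xs : ℝ → Vec d}

lemma CostAssumption.differentiable_fst (h : CostAssumption f ζ mᵢ Mᵢ) (i : Fin N) (w : Vec l) :
    Differentiable ℝ fun x => f i x w :=
  ((h.smooth i).differentiable (by norm_num)).comp (differentiable_id.prodMk
    (differentiable_const w))

lemma CostAssumption.contDiff_gradX (h : CostAssumption f ζ mᵢ Mᵢ) (i : Fin N) :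
    ContDiff ℝ 2 fun p : Vec d × Vec l => gradX f i p.1 p.2 := by
  have h1 : ContDiff ℝ 2 fun p : Vec d × Vec l => fderiv ℝ (fun y => f i y p.2) p.1 := by
    refine ContDiff.fderiv (f := fun (p : Vec d × Vec l) y => f i y p.2) (m := 3) ?_
      contDiff_fst (by norm_num)
    exact (h.smooth i).comp (contDiff_snd.prodMk (contDiff_snd.comp contDiff_fst))
  exact (InnerProductSpace.toDual ℝ (Vec d)).symm.toContinuousLinearEquiv.contDiff.comp h1

lemma CostAssumption.strongMono (h : CostAssumption f ζ mᵢ Mᵢ) (i : Fin N) (t : ℝ) (x y : Vec d) :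
    mᵢ i * ‖x - y‖ ^ 2 ≤ inner ℝ (gradX f i x (ζ t) - gradX f i y (ζ t)) (x - y) :=
  le_inner_gradient_sub (h.differentiable_fst i (ζ t)) (h.strongConvex i t) x y

lemma sum_gradX_eq_zero (h : CostAssumption f ζ mᵢ Mᵢ) (hxs : IsOptimum f ζ xs) (t : ℝ) :
    ∑ i, gradX f i (xs t) (ζ t) = 0 := by
  have h1 : HasGradientAt (fun x => ∑ i, f i x (ζ t)) (∑ i, gradX f i (xs t) (ζ t)) (xs t) := by
    rw [hasGradientAt_iff_hasFDerivAt, map_sum]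
    exact HasFDerivAt.fun_sum fun i _ =>
      ((h.differentiable_fst i (ζ t)) (xs t)).hasGradientAt.hasFDerivAt
  have h2 := (hxs t).isLocalMin univ_mem |>.hasFDerivAt_eq_zero h1.hasFDerivAt
  rwa [LinearIsometryEquiv.map_eq_zero_iff] at h2

/-- The summed gradient is strongly monotone with modulus `∑ m_i`, positive because `N > 0`, and
vanishes at `x*`. Without differentiability, `deriv xs` in the growth bound would carry no
information. -/
lemma differentiable_optimum (h : CostAssumption f ζ mᵢ Mᵢ) (hxs : IsOptimum f ζ xs)
    (hζ : Differentiable ℝ ζ) (hN : 0 < N) : Differentiable ℝ xs := by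
  intro t
  have : Nonempty (Fin N) := ⟨⟨0, hN⟩⟩
  refine differentiableAt_zero_of_strongMono
    (F := fun p : Vec d × Vec l => ∑ i, gradX f i p.1 p.2) (m := ∑ i, mᵢ i)
    (Finset.sum_pos (fun i _ => h.pos i) Finset.univ_nonempty)
    (Differentiable.fun_sum fun i _ => (h.contDiff_gradX i).differentiable two_ne_zero)
    (fun s x y => ?_) (fun s => sum_gradX_eq_zero h hxs s) (hζ t)
  rw [← Finset.sum_sub_distrib, sum_inner, Finset.sum_mul]
  exact Finset.sum_le_sum fun i _ => h.strongMono i s x y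

end Cost

/-! ### A Lyapunov argument with a slow and a fast part -/

section Lyapunov

/-- Young's inequality: each of the two `n` cross terms is charged `κ/8 * n²`, and `r X` is charged
a quarter of the damping `a q X²`. The choice of `ε` absorbs `C₂ n²`; smallness of `q` absorbs the
terms in `q² X²`. What remains is of order `r²/q`. -/
lemma lyapunov_deriv_le {ε κ a B C₁ C₂ C₃ C₄ C₅ q r X n dx dn : ℝ} (hκ : 0 < κ) (ha : 0 < a)
    (hq : 0 < q) (hq1 : q ≤ 1) (hε : 0 < ε) (hεC : ε * C₂ ≤ κ / 2)
    (hdx : dx ≤ C₁ * q ^ 2 * X ^ 2 - a * q * X ^ 2 + C₂ * n ^ 2 + C₃ * r * X)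
    (hdn : dn ≤ -κ * n ^ 2 + B * n * (C₄ * q * X + C₅ * r))
    (hsmall : (ε * C₁ + 2 * B ^ 2 * C₄ ^ 2 / κ) * q ≤ ε * a / 4) :
    ε * (2 * dx) + 2 * dn ≤ -(κ / 2 * n ^ 2 + ε * a * q * X ^ 2)
      + 2 * (2 * B ^ 2 * C₅ ^ 2 / κ + ε * C₃ ^ 2 / a) * (r ^ 2 / q) := by
  have h1 : B * n * (C₄ * q * X) ≤ κ / 8 * n ^ 2 + 2 * B ^ 2 * C₄ ^ 2 / κ * q ^ 2 * X ^ 2 := by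
    have : 0 ≤ κ / 8 * (n - 4 * B * C₄ * q * X / κ) ^ 2 := by positivity
    have e : κ / 8 * (n - 4 * B * C₄ * q * X / κ) ^ 2
      = κ / 8 * n ^ 2 + 2 * B ^ 2 * C₄ ^ 2 / κ * q ^ 2 * X ^ 2 - B * n * (C₄ * q * X) := by
      field_simp
      ring
    linarith
  have h2 : B * n * (C₅ * r) ≤ κ / 8 * n ^ 2 + 2 * B ^ 2 * C₅ ^ 2 / κ * r ^ 2 := by
    have : 0 ≤ κ / 8 * (n - 4 * B * C₅ * r / κ) ^ 2 := by positivity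
    have e : κ / 8 * (n - 4 * B * C₅ * r / κ) ^ 2
      = κ / 8 * n ^ 2 + 2 * B ^ 2 * C₅ ^ 2 / κ * r ^ 2 - B * n * (C₅ * r) := by
      field_simp
      ring
    linarith
  have h3 : C₃ * r * X ≤ a * q * X ^ 2 / 4 + C₃ ^ 2 / a * (r ^ 2 / q) := by
    have : 0 ≤ a * q / 4 * (X - 2 * C₃ * r / (a * q)) ^ 2 := by positivity
    have e : a * q / 4 * (X - 2 * C₃ * r / (a * q)) ^ 2
      = a * q * X ^ 2 / 4 + C₃ ^ 2 / a * (r ^ 2 / q) - C₃ * r * X := by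
      field_simp
      ring
    linarith
  have h4 : 2 * B ^ 2 * C₅ ^ 2 / κ * r ^ 2 ≤ 2 * B ^ 2 * C₅ ^ 2 / κ * (r ^ 2 / q) :=
    mul_le_mul_of_nonneg_left (by rw [le_div_iff₀ hq]; nlinarith [sq_nonneg r]) (by positivity)
  have h5 := mul_le_mul_of_nonneg_left hsmall (show 0 ≤ q * X ^ 2 by positivity)
  have h6 := mul_le_mul_of_nonneg_left (hdx.trans (add_le_add_right h3 _)) hε.le
  have h7 := mul_le_mul_of_nonneg_right hεC (sq_nonneg n)
  have e : ε * (C₃ ^ 2 / a * (r ^ 2 / q)) = ε * C₃ ^ 2 / a * (r ^ 2 / q) := by ring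
  nlinarith

lemma tendsto_zero_of_mul_sq_le {H : Type*} [NormedAddCommGroup H] {ε : ℝ}
    (hε : 0 < ε) {x : ℝ → H} {V : ℝ → ℝ}
    (hV : Tendsto V atTop (𝓝 0)) (h : ∀ t, ε * ‖x t‖ ^ 2 ≤ V t) : Tendsto x atTop (𝓝 0) := by
  have h1 : Tendsto (fun t => ‖x t‖ ^ 2) atTop (𝓝 0) := by
    refine squeeze_zero (fun t => sq_nonneg _) (fun t => ?_) (g := fun t => V t / ε) ?_
    · rw [le_div_iff₀ hε]
      linarith [h t]
    · simpa using hV.div_const ε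
  have h2 := h1.sqrt
  simp only [Real.sqrt_sq (norm_nonneg _), Real.sqrt_zero] at h2
  exact tendsto_zero_iff_norm_tendsto_zero.2 h2

variable {H E : Type*} [NormedAddCommGroup H] [InnerProductSpace ℝ H]
  [NormedAddCommGroup E] [InnerProductSpace ℝ E]

/-- The coordinate `n` is exponentially stable up to perturbations of order `q`, while `x` is
damped at the vanishing but non-integrable rate `q`. -/
theorem tendsto_zero_of_slow_fast {P F : E →L[ℝ] E} {lam κ a C₁ C₂ C₃ C₄ C₅ : ℝ}
    (hP : ∀ u v, inner ℝ (P u) v = inner ℝ u (P v)) (hlam : 0 < lam)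
    (hPlam : ∀ u, lam * ‖u‖ ^ 2 ≤ inner ℝ u (P u)) (hκ : 0 < κ)
    (hF : ∀ u, inner ℝ (F u) (P u) ≤ -κ * ‖u‖ ^ 2) (ha : 0 < a) (hC₂ : 0 ≤ C₂)
    {x x' : ℝ → H} {n n' : ℝ → E} {q r A : ℝ → ℝ}
    (hx : ∀ᶠ t in atTop, HasDerivAt x (x' t) t) (hn : ∀ᶠ t in atTop, HasDerivAt n (n' t) t)
    (hq0 : ∀ᶠ t in atTop, 0 < q t) (hq : Tendsto q atTop (𝓝 0))
    (hA : ∀ᶠ t in atTop, HasDerivAt A (q t) t) (hAtop : Tendsto A atTop atTop)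
    (hr : ∀ ε > 0, ∀ᶠ t in atTop, r t ^ 2 ≤ ε * q t ^ 2)
    (hdx : ∀ᶠ t in atTop, inner ℝ (x' t) (x t) ≤ C₁ * q t ^ 2 * ‖x t‖ ^ 2
      - a * q t * ‖x t‖ ^ 2 + C₂ * ‖n t‖ ^ 2 + C₃ * r t * ‖x t‖)
    (hdn : ∀ᶠ t in atTop, ‖n' t - F (n t)‖ ≤ C₄ * q t * ‖x t‖ + C₅ * r t) :
    Tendsto x atTop (𝓝 0) ∧ Tendsto n atTop (𝓝 0) := by
  set B := ‖P‖
  have hB : 0 ≤ B := norm_nonneg P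
  -- Ensures `ε C₂ ≤ κ/2`; the `+ 1` avoids division by zero.
  set ε := κ / (2 * (C₂ + 1))
  have hε : 0 < ε := by positivity
  have hεC : ε * C₂ ≤ κ / 2 := by
    rw [div_mul_eq_mul_div, div_le_div_iff₀ (by positivity) two_pos]
    nlinarith
  -- A rate valid for both parts of `V`: `κ' ≤ a` serves `x`, and `κ' B ≤ κ/2` with `q ≤ 1` serves
  -- `n`.
  set κ' := min a (κ / (2 * (B + 1)))
  have hκ' : 0 < κ' := lt_min ha (by positivity)
  have hκ'B : κ' * B ≤ κ / 2 := by
    have h1 : κ' ≤ κ / (2 * (B + 1)) := min_le_right _ _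
    rw [le_div_iff₀ (by positivity)] at h1
    nlinarith
  set K := 2 * (2 * B ^ 2 * C₅ ^ 2 / κ + ε * C₃ ^ 2 / a)
  have hK : 0 ≤ K := by positivity
  have hV : Tendsto (fun t => ε * ‖x t‖ ^ 2 + inner ℝ (n t) (P (n t))) atTop (𝓝 0) := by
    refine tendsto_zero_of_deriv_le
      (V' := fun t => ε * (2 * inner ℝ (x t) (x' t))
        + (inner ℝ (n t) (P (n' t)) + inner ℝ (n' t) (P (n t))))
      (A := fun t => κ' * A t) (a := fun t => κ' * q t) (b := fun t => K * (r t ^ 2 / q t))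
      ?_ ?_ ?_ (hAtop.const_mul_atTop hκ') ?_ ?_
    · filter_upwards [hx, hn] with t h1 h2
      exact (h1.norm_sq.const_mul ε).add (h2.inner ℝ (P.hasFDerivAt.comp_hasDerivAt t h2))
    · refine Eventually.of_forall fun t => add_nonneg (by positivity) ?_
      exact le_trans (by positivity) (hPlam (n t))
    · filter_upwards [hA] with t ht using ht.const_mul κ'
    · have hs : ∀ᶠ t in atTop, (ε * C₁ + 2 * B ^ 2 * C₄ ^ 2 / κ) * q t ≤ ε * a / 4 := by
        have := hq.const_mul (ε * C₁ + 2 * B ^ 2 * C₄ ^ 2 / κ)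
        rw [mul_zero] at this
        exact this.eventually_le_const (by positivity)
      filter_upwards [hq0, hq.eventually_le_const one_pos, hs, hdx, hdn]
        with t hq0 hq1 hs hdx hdn
      have e1 : inner ℝ (n t) (P (n' t)) = inner ℝ (n' t) (P (n t)) := by
        rw [← hP, real_inner_comm]
      have hdn' : inner ℝ (n' t) (P (n t))
          ≤ -κ * ‖n t‖ ^ 2 + B * ‖n t‖ * (C₄ * q t * ‖x t‖ + C₅ * r t) := by
        have e2 : inner ℝ (n' t) (P (n t))
            = inner ℝ (F (n t)) (P (n t)) + inner ℝ (n' t - F (n t)) (P (n t)) := by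
          rw [← inner_add_left, add_sub_cancel]
        have h1 : inner ℝ (n' t - F (n t)) (P (n t))
            ≤ (C₄ * q t * ‖x t‖ + C₅ * r t) * (B * ‖n t‖) :=
          (real_inner_le_norm _ _).trans (mul_le_mul hdn (P.le_opNorm _) (norm_nonneg _)
            ((norm_nonneg _).trans hdn))
        linarith [hF (n t)]
      have h := lyapunov_deriv_le hκ ha hq0 hq1 hε hεC hdx hdn' hs
      have hPB : inner ℝ (n t) (P (n t)) ≤ B * ‖n t‖ ^ 2 := by
        refine (real_inner_le_norm _ _).trans ?_
        nlinarith [P.le_opNorm (n t), norm_nonneg (n t)]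
      have h2 : κ' * q t * (ε * ‖x t‖ ^ 2) ≤ ε * a * q t * ‖x t‖ ^ 2 := by
        have : κ' ≤ a := min_le_left _ _
        have := mul_le_mul_of_nonneg_right this
          (show 0 ≤ q t * (ε * ‖x t‖ ^ 2) by positivity)
        linarith
      have h3 : κ' * q t * inner ℝ (n t) (P (n t)) ≤ κ / 2 * ‖n t‖ ^ 2 :=
        calc κ' * q t * inner ℝ (n t) (P (n t)) ≤ κ' * q t * (B * ‖n t‖ ^ 2) := by gcongr
          _ = q t * (κ' * B * ‖n t‖ ^ 2) := by ring
          _ ≤ 1 * (κ' * B * ‖n t‖ ^ 2) := by gcongr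
          _ ≤ κ / 2 * ‖n t‖ ^ 2 := by rw [one_mul]; gcongr
      rw [e1, real_inner_comm]
      linarith
    -- `r² = o(q²)` makes the forcing `K r²/q` negligible against the rate `κ' q`.
    · intro δ hδ
      filter_upwards [hq0, hr (δ * κ' / (K + 1)) (by positivity)] with t hq0 hr
      have h1 : K * r t ^ 2 ≤ δ * κ' * q t ^ 2 := by
        rw [div_mul_eq_mul_div, le_div_iff₀ (by positivity)] at hr
        nlinarith [sq_nonneg (r t)]
      rw [← mul_div_assoc, div_le_iff₀ hq0]
      linarith
  refine ⟨tendsto_zero_of_mul_sq_le hε hV fun t => ?_,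
    tendsto_zero_of_mul_sq_le hlam hV fun t => ?_⟩
  · have : 0 ≤ lam * ‖n t‖ ^ 2 := by positivity
    linarith [hPlam (n t)]
  · have : 0 ≤ ε * ‖x t‖ ^ 2 := by positivity
    linarith [hPlam (n t)]

end Lyapunov

/-! ### Matrix identities -/

section Matrices

lemma laplacian_mulVec_const {N : ℕ} (G : Digraph (Fin N)) (s : ℝ) :
    laplacian G *ᵥ (fun _ => s) = 0 := by
  ext i
  simp [laplacian, outDegree, mulVec, dotProduct, ← Finset.sum_mul, diagonal_apply]

lemma const_vecMul_laplacian {N : ℕ} {G : Digraph (Fin N)} (hG : GraphAssumption G) (s : ℝ) :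
    (fun _ => s) ᵥ* laplacian G = 0 := by
  ext j
  have := hG.balanced j
  simp only [inDegree] at this
  simp [laplacian, vecMul, dotProduct, ← Finset.mul_sum, this, diagonal_apply]

/-- `[R r]` is square, as `(N - 1) + 1 = N` for `N > 0`, and its transpose is a left inverse, hence
also a right inverse. -/
lemma mul_transpose_add_rVec {N : ℕ} (hN : 0 < N) {R : Matrix (Fin N) (Fin (N - 1)) ℝ}
    (hRr : Rᵀ *ᵥ rVec N = 0) (hRR : Rᵀ * R = 1) :
    R * Rᵀ + vecMulVec (rVec N) (rVec N) = 1 := by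
  have hr : rVec N ⬝ᵥ rVec N = 1 := by
    have : (0 : ℝ) < N := by exact_mod_cast hN
    simp only [dotProduct, rVec, Finset.sum_const, Finset.card_univ, Fintype.card_fin, nsmul_eq_mul]
    rw [div_mul_div_comm, Real.mul_self_sqrt this.le]
    field_simp
  have h1 : fromRows Rᵀ (replicateRow Unit (rVec N)) * fromCols R (replicateCol Unit (rVec N))
      = 1 := by
    rw [fromRows_mul_fromCols, hRR, ← fromBlocks_one]
    congr 1
    · ext i j
      simpa [mul_apply, mulVec, dotProduct] using congrFun hRr i
    · ext i j
      simpa [mul_apply, mulVec, dotProduct, mul_comm] using congrFun hRr j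
    · ext i j
      simpa [mul_apply, dotProduct] using hr
  have h2 := (mul_eq_one_comm_of_card_eq _ _ _ (by simp; omega)).1 h1
  rw [fromCols_mul_fromRows] at h2
  rw [← h2]
  congr 1
  ext i j
  simp [mul_apply, vecMulVec_apply]

variable {n : Type*} [Fintype n] [DecidableEq n]

/-- The linear dynamics of the disagreement components of `x` and `z`. -/
def disagreementDyn (γ : ℝ) (A : Matrix n n ℝ) : Matrix (n ⊕ n) (n ⊕ n) ℝ :=
  fromBlocks (-A) (-1) (γ • A) 0

/-- The leading 2 × 2 blocks of `Φ₂` equal `QF + (QF)ᵀ`, except that the lower right corner has only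
half of `-(P₂ + P₂ᵀ)`. The missing half is again a diagonal block of `Φ₂`, so restoring it keeps
definiteness. -/
lemma posDef_lyapunov {p : Params} {p₁₁ p₂₂ δ : ℝ} {A P₂ P₃ : Matrix n n ℝ} (hP₃ : P₃.PosDef)
    (h : NegDef (Phi2 p p₁₁ p₂₂ δ A P₂ P₃)) :
    (-(lyapBlock p₂₂ P₂ P₃ * disagreementDyn p.γ A
      + (lyapBlock p₂₂ P₂ P₃ * disagreementDyn p.γ A)ᵀ)).PosDef := by
  have h1 := PosDef.submatrix h (e := Sum.inl) Sum.inl_injective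
  have h2 := PosDef.submatrix h1 (e := Sum.inr) Sum.inr_injective
  have h3 := h2.posSemidef.mul_mul_conjTranspose_same
    (fromRows (0 : Matrix n n ℝ) (1 : Matrix n n ℝ))
  have hP₃' : P₃ᵀ = P₃ := by simpa using hP₃.isHermitian.eq
  convert h1.add_posSemidef h3 using 1
  rw [lyapBlock, disagreementDyn, fromBlocks_multiply, conjTranspose_eq_transpose_of_trivial,
    transpose_fromRows, fromRows_mul, fromRows_mul_fromCols, fromBlocks_transpose,
    fromBlocks_add, fromBlocks_neg]
  ext (i | i) (j | j)
  all_goals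
    simp [Phi2, Phi21, Phi22, hP₃']
    try ring

end Matrices

/-! ### Convergence of the consensus dynamics -/

section Pi

variable {ι V : Type*} [Fintype ι] [NormedAddCommGroup V]

lemma hasDerivAt_toLp [NormedSpace ℝ V] {x : ℝ → ι → V} {x' : ι → V} {t : ℝ}
    (h : HasDerivAt x x' t) :
    HasDerivAt (fun s => (WithLp.toLp 2 (x s) : PiLp 2 fun _ : ι => V)) (WithLp.toLp 2 x') t :=
  ((PiLp.continuousLinearEquiv 2 ℝ fun _ : ι => V).symm.hasFDerivAt).comp_hasDerivAt t h

lemma norm_le_mul_norm_of_forall {u v : PiLp 2 fun _ : ι => V} {c : ℝ} (hc : 0 ≤ c)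
    (h : ∀ i, ‖u i‖ ≤ c * ‖v i‖) : ‖u‖ ≤ c * ‖v‖ := by
  refine le_of_sq_le_sq ?_ (by positivity)
  rw [mul_pow, PiLp.norm_sq_eq_of_L2, PiLp.norm_sq_eq_of_L2, Finset.mul_sum]
  refine Finset.sum_le_sum fun i _ => ?_
  rw [← mul_pow]
  exact pow_le_pow_left₀ (norm_nonneg _) (h i) 2

lemma norm_le_card_mul_of_forall {u : PiLp 2 fun _ : ι => V} {c : ℝ} (hc : 0 ≤ c)
    (h : ∀ i, ‖u i‖ ≤ c) : ‖u‖ ≤ Fintype.card ι * c := by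
  refine le_of_sq_le_sq ?_ (by positivity)
  rw [PiLp.norm_sq_eq_of_L2]
  calc ∑ i, ‖u i‖ ^ 2 ≤ ∑ _i : ι, c ^ 2 :=
        Finset.sum_le_sum fun i _ => pow_le_pow_left₀ (norm_nonneg _) (h i) 2
    _ = Fintype.card ι * c ^ 2 := by simp
    _ ≤ (Fintype.card ι * c) ^ 2 := by
        rw [mul_pow]
        gcongr
        exact_mod_cast Nat.le_self_pow two_ne_zero _

end Pi

section Consensus

variable {V : Type*} [NormedAddCommGroup V] [InnerProductSpace ℝ V] [FiniteDimensional ℝ V]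

lemma act_one {ι : Type*} [Fintype ι] [DecidableEq ι] (u : PiLp 2 (fun _ : ι => V)) :
    act V (1 : Matrix ι ι ℝ) u = u := by
  ext i : 1
  simp [Matrix.one_apply, ite_smul]

/-- Convergence of the Laplacian feedback `x' = σ x - a h - L x - z - D`, `z' = γ L x - e`
when `h` is a monotone feedback of order `q`, and `D`, `e` are of order `r = o(q)`. -/
theorem consensus_tendsto_zero {N : ℕ} (hN : 0 < N) {p : Params}
    {R : Matrix (Fin N) (Fin (N - 1)) ℝ} {L : Matrix (Fin N) (Fin N) ℝ}
    (hRr : Rᵀ *ᵥ rVec N = 0) (hRR : Rᵀ * R = 1)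
    (hL₁ : L *ᵥ rVec N = 0) (hL₂ : rVec N ᵥ* L = 0)
    {P₂ P₃ : Matrix (Fin (N - 1)) (Fin (N - 1)) ℝ} {p₁₁ p₂₂ δ : ℝ} (hP₃ : P₃.PosDef)
    (hP : (lyapBlock p₂₂ P₂ P₃).PosDef) (hΦ₂ : NegDef (Phi2 p p₁₁ p₂₂ δ (Rᵀ * L * R) P₂ P₃))
    {x z h D e : ℝ → PiLp 2 (fun _ : Fin N => V)} {σ q r A : ℝ → ℝ} {a m M C S : ℝ}
    (ha : 0 < a) (hm : 0 < m)
    (hx : ∀ᶠ t in atTop,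
      HasDerivAt x (σ t • x t - a • h t - act V L (x t) - z t - D t) t)
    (hz : ∀ᶠ t in atTop, HasDerivAt z (p.γ • act V L (x t) - e t) t)
    (hzr : ∀ᶠ t in atTop, act V (vecMulVec (rVec N) (rVec N)) (z t) = 0)
    (hhn : ∀ᶠ t in atTop, ‖h t‖ ≤ M * q t * ‖x t‖)
    (hhx : ∀ᶠ t in atTop, m * q t * ‖x t‖ ^ 2 ≤ inner ℝ (h t) (x t))
    (hD : ∀ᶠ t in atTop, ‖D t‖ ≤ C * r t) (he : ∀ᶠ t in atTop, ‖e t‖ ≤ C * r t)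
    (hσ : ∀ᶠ t in atTop, |σ t| ≤ S * q t ^ 2)
    (hq0 : ∀ᶠ t in atTop, 0 < q t) (hq : Tendsto q atTop (𝓝 0))
    (hA : ∀ᶠ t in atTop, HasDerivAt A (q t) t) (hAtop : Tendsto A atTop atTop)
    (hr : ∀ ε > 0, ∀ᶠ t in atTop, r t ^ 2 ≤ ε * q t ^ 2) :
    Tendsto x atTop (𝓝 0) ∧ Tendsto z atTop (𝓝 0) := by
  set B := Rᵀ * L * R with hB
  have hRRT := mul_transpose_add_rVec hN hRr hRR
  -- `RRᵀ` is the projection orthogonal to `r`, which `L` annihilates on both sides; hence `L = R B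
  -- Rᵀ`.
  have hLR : L * (R * Rᵀ) = L := by
    have := congrArg (L * ·) hRRT
    simpa [Matrix.mul_add, Matrix.mul_vecMulVec, hL₁] using this
  have hRL : R * Rᵀ * L = L := by
    have := congrArg (· * L) hRRT
    simpa [Matrix.add_mul, Matrix.vecMulVec_mul, hL₂] using this
  have hBR : B * Rᵀ = Rᵀ * L := by
    rw [hB, Matrix.mul_assoc, Matrix.mul_assoc, hLR]
  have hRBR : R * (B * Rᵀ) = L := by
    rw [hBR, ← Matrix.mul_assoc, hRL]
  set F := disagreementDyn p.γ B with hF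
  set Q := lyapBlock p₂₂ P₂ P₃
  -- `K₁`, `K₂` place `Rᵀx`, `Rᵀz` in the two slots of `n`; `J₁`, `J₂` read them back.
  set K₁ : Matrix (Fin (N - 1) ⊕ Fin (N - 1)) (Fin N) ℝ := fromRows Rᵀ 0 with hK₁
  set K₂ : Matrix (Fin (N - 1) ⊕ Fin (N - 1)) (Fin N) ℝ := fromRows 0 Rᵀ with hK₂
  set J₁ : Matrix (Fin (N - 1)) (Fin (N - 1) ⊕ Fin (N - 1)) ℝ := fromCols 1 0 with hJ₁
  set J₂ : Matrix (Fin (N - 1)) (Fin (N - 1) ⊕ Fin (N - 1)) ℝ := fromCols 0 1 with hJ₂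
  have hFK₁ : F * K₁ = p.γ • (K₂ * L) + -(K₁ * L) := by
    rw [hF, disagreementDyn, hK₁, hK₂, fromBlocks_mul_fromRows, fromRows_mul, fromRows_mul]
    ext (i | i) j <;> simp [hBR]
  have hFK₂ : F * K₂ = -K₁ := by
    rw [hF, disagreementDyn, hK₁, hK₂, fromBlocks_mul_fromRows]
    ext (i | i) j <;> simp
  have hJK : J₁ * K₁ = Rᵀ ∧ J₁ * K₂ = 0 ∧ J₂ * K₁ = 0 ∧ J₂ * K₂ = Rᵀ := by
    simp [hJ₁, hJ₂, hK₁, hK₂, fromCols_mul_fromRows]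
  obtain ⟨hJK₁₁, hJK₁₂, hJK₂₁, hJK₂₂⟩ := hJK
  set n := fun t => act V K₁ (x t) + act V K₂ (z t) with hn_def
  have act_zero : ∀ u : PiLp 2 (fun _ : Fin N => V),
      act V (0 : Matrix (Fin (N - 1)) (Fin N) ℝ) u = 0 := fun u => by
    simpa using act_smul (0 : ℝ) (0 : Matrix (Fin (N - 1)) (Fin N) ℝ) u
  have hJ₁n : ∀ t, act V J₁ (n t) = act V Rᵀ (x t) := fun t => by
    rw [hn_def, map_add, ← act_mul, ← act_mul, hJK₁₁, hJK₁₂, act_zero, add_zero]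
  have hJ₂n : ∀ t, act V J₂ (n t) = act V Rᵀ (z t) := fun t => by
    rw [hn_def, map_add, ← act_mul, ← act_mul, hJK₂₁, hJK₂₂, act_zero, zero_add]
  have hFn : ∀ t, act V F (n t) = p.γ • act V K₂ (act V L (x t)) - act V K₁ (act V L (x t))
      - act V K₁ (z t) := fun t => by
    rw [hn_def, map_add, ← act_mul, ← act_mul, hFK₁, hFK₂, act_add, act_neg, act_neg, act_smul,
      act_mul, act_mul]
    abel
  have hzR : ∀ᶠ t in atTop, z t = act V R (act V Rᵀ (z t)) := by
    filter_upwards [hzr] with t ht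
    have := act_one (z t)
    rw [← hRRT, act_add, ht, add_zero, act_mul] at this
    exact this.symm
  obtain ⟨lam, hlam, hQlam⟩ := exists_inner_act_ge V hP
  obtain ⟨κ, hκ, hκle⟩ := exists_inner_act_ge V (posDef_lyapunov hP₃ hΦ₂)
  have hQT : Qᵀ = Q := by simpa using hP.isHermitian.eq
  -- `κ / 2` because the symmetrised form counts `⟨F u, Q u⟩` twice.
  have key := tendsto_zero_of_slow_fast (P := act V Q) (F := act V F) (κ := κ / 2) (a := a * m)
    (lam := lam) (C₁ := S) (C₂ := ‖act V B‖ * ‖act V J₁‖ ^ 2 + ‖act V J₂‖ * ‖act V J₁‖)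
    (C₃ := C) (C₄ := ‖act V K₁‖ * (S + a * M)) (C₅ := (‖act V K₁‖ + ‖act V K₂‖) * C)
    (x := x) (n := n) (q := q) (r := r) (A := A)
    (n' := fun t => act V K₁ (σ t • x t - a • h t - act V L (x t) - z t - D t)
      + act V K₂ (p.γ • act V L (x t) - e t))
    (fun u v => by rw [inner_act, hQT]) hlam hQlam (half_pos hκ) ?_ (mul_pos ha hm)
    (by positivity) hx ?_ hq0 hq hA hAtop hr ?_ ?_
  · refine ⟨key.1, ?_⟩
    have h1 : Tendsto (fun t => act V R (act V J₂ (n t))) atTop (𝓝 0) := by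
      have hc : Continuous fun u => act V R (act V J₂ u) :=
        (act V R).continuous.comp (act V J₂).continuous
      have h0 := (hc.tendsto 0).comp key.2
      simp only [map_zero] at h0
      exact h0
    refine h1.congr' ?_
    filter_upwards [hzR] with t ht
    rw [hJ₂n, ← ht]
  · intro u
    have h1 := hκle u
    rw [act_neg, inner_neg_right, act_add, inner_add_right, ← inner_act, act_mul,
      real_inner_comm] at h1
    have h2 : inner ℝ (act V Q (act V F u)) u = inner ℝ (act V F u) (act V Q u) := by
      rw [inner_act, hQT]
    rw [h2] at h1
    linarith
  · filter_upwards [hx, hz] with t h1 h2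
    exact ((act V K₁).hasFDerivAt.comp_hasDerivAt t h1).add
      ((act V K₂).hasFDerivAt.comp_hasDerivAt t h2)
  -- Both `⟨L x, x⟩` and `⟨z, x⟩` depend on `n` alone, through `L = R B Rᵀ` and `z = R Rᵀ z`, so
  -- each is `O(‖n‖²)`.
  · filter_upwards [hzR, hhx, hD, hσ] with t hzR hhx hD hσ
    have h1 : inner ℝ (act V L (x t)) (x t)
        = inner ℝ (act V B (act V J₁ (n t))) (act V J₁ (n t)) := by
      rw [hJ₁n]
      conv_lhs => rw [← hRBR]
      rw [act_mul, act_mul, inner_act]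
    have h2 : inner ℝ (z t) (x t) = inner ℝ (act V J₂ (n t)) (act V J₁ (n t)) := by
      rw [hJ₁n, hJ₂n]
      conv_lhs => rw [hzR]
      rw [inner_act]
    have h3 : -inner ℝ (act V L (x t)) (x t) ≤ ‖act V B‖ * ‖act V J₁‖ ^ 2 * ‖n t‖ ^ 2 := by
      rw [h1]
      calc _ ≤ ‖act V B (act V J₁ (n t))‖ * ‖act V J₁ (n t)‖ :=
            (neg_le_abs _).trans (abs_real_inner_le_norm _ _)
        _ ≤ ‖act V B‖ * (‖act V J₁‖ * ‖n t‖) * (‖act V J₁‖ * ‖n t‖) := by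
            gcongr
            · exact (act V B).le_opNorm_of_le ((act V J₁).le_opNorm _)
            · exact (act V J₁).le_opNorm _
        _ = _ := by ring
    have h4 : -inner ℝ (z t) (x t) ≤ ‖act V J₂‖ * ‖act V J₁‖ * ‖n t‖ ^ 2 := by
      rw [h2]
      calc _ ≤ ‖act V J₂ (n t)‖ * ‖act V J₁ (n t)‖ :=
            (neg_le_abs _).trans (abs_real_inner_le_norm _ _)
        _ ≤ (‖act V J₂‖ * ‖n t‖) * (‖act V J₁‖ * ‖n t‖) := by
            gcongr
            · exact (act V J₂).le_opNorm _
            · exact (act V J₁).le_opNorm _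
        _ = _ := by ring
    have h5 : -inner ℝ (D t) (x t) ≤ C * r t * ‖x t‖ :=
      ((neg_le_abs _).trans (abs_real_inner_le_norm _ _)).trans
        (mul_le_mul_of_nonneg_right hD (norm_nonneg _))
    have h6 := mul_le_mul_of_nonneg_right ((le_abs_self _).trans hσ) (sq_nonneg ‖x t‖)
    have h7 := mul_le_mul_of_nonneg_left hhx ha.le
    simp only [inner_sub_left, real_inner_smul_left, real_inner_self_eq_norm_sq]
    linarith
  · filter_upwards [hhn, hD, he, hσ, hq0, hq.eventually_le_const one_pos]
      with t hhn hD he hσ hq0 hq1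
    -- The Laplacian and `z` terms cancel exactly against `F n`, leaving only small ones.
    have e1 : act V K₁ (σ t • x t - a • h t - act V L (x t) - z t - D t)
        + act V K₂ (p.γ • act V L (x t) - e t) - act V F (n t)
        = act V K₁ (σ t • x t - a • h t - D t) - act V K₂ (e t) := by
      rw [hFn]
      simp only [map_sub, map_smul]
      abel
    rw [e1]
    have hσ' : |σ t| ≤ S * q t := by
      have hS : 0 ≤ S := by
        by_contra hS
        have : S * q t ^ 2 < 0 := mul_neg_of_neg_of_pos (not_le.1 hS) (by positivity)
        linarith [abs_nonneg (σ t)]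
      refine hσ.trans ?_
      have : q t ^ 2 ≤ q t := by nlinarith
      gcongr
    have h1 : ‖σ t • x t - a • h t - D t‖ ≤ (S + a * M) * q t * ‖x t‖ + C * r t := by
      have h2 : ‖σ t • x t‖ ≤ S * q t * ‖x t‖ := by
        rw [norm_smul, Real.norm_eq_abs]
        gcongr
      have h3 : ‖a • h t‖ ≤ a * (M * q t * ‖x t‖) := by
        rw [norm_smul, Real.norm_eq_abs, abs_of_pos ha]
        gcongr
      have := (norm_sub_le (σ t • x t - a • h t) (D t)).trans
        (add_le_add (norm_sub_le _ _) hD)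
      linarith
    have h4 := (act V K₁).le_opNorm_of_le h1
    have h5 := (act V K₂).le_opNorm_of_le he
    have := norm_sub_le (act V K₁ (σ t • x t - a • h t - D t)) (act V K₂ (e t))
    linarith

/-- The componentwise form of `consensus_tendsto_zero`. -/
theorem consensus_tendsto_zero_pi {N : ℕ} (hN : 0 < N) {p : Params}
    {R : Matrix (Fin N) (Fin (N - 1)) ℝ} {L : Matrix (Fin N) (Fin N) ℝ}
    (hRr : Rᵀ *ᵥ rVec N = 0) (hRR : Rᵀ * R = 1)
    (hL₁ : L *ᵥ rVec N = 0) (hL₂ : rVec N ᵥ* L = 0)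
    {P₂ P₃ : Matrix (Fin (N - 1)) (Fin (N - 1)) ℝ} {p₁₁ p₂₂ δ : ℝ} (hP₃ : P₃.PosDef)
    (hP : (lyapBlock p₂₂ P₂ P₃).PosDef) (hΦ₂ : NegDef (Phi2 p p₁₁ p₂₂ δ (Rᵀ * L * R) P₂ P₃))
    {x z h D e : ℝ → Fin N → V} {σ q r A : ℝ → ℝ} {a m M C S : ℝ}
    (ha : 0 < a) (hm : 0 < m) (hM : 0 ≤ M) (hC : 0 ≤ C)
    (hx : ∀ᶠ t in atTop, HasDerivAt x
      (fun i => σ t • x t i - a • h t i - ∑ j, L i j • x t j - z t i - D t i) t)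
    (hz : ∀ᶠ t in atTop, HasDerivAt z (fun i => p.γ • ∑ j, L i j • x t j - e t i) t)
    (hzr : ∀ᶠ t in atTop, ∑ i, z t i = 0)
    (hhn : ∀ᶠ t in atTop, ∀ i, ‖h t i‖ ≤ M * q t * ‖x t i‖)
    (hhx : ∀ᶠ t in atTop, ∀ i, m * q t * ‖x t i‖ ^ 2 ≤ inner ℝ (h t i) (x t i))
    (hD : ∀ᶠ t in atTop, ∀ i, ‖D t i‖ ≤ C * r t) (he : ∀ᶠ t in atTop, ∀ i, ‖e t i‖ ≤ C * r t)
    (hσ : ∀ᶠ t in atTop, |σ t| ≤ S * q t ^ 2)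
    (hq0 : ∀ᶠ t in atTop, 0 < q t) (hq : Tendsto q atTop (𝓝 0))
    (hA : ∀ᶠ t in atTop, HasDerivAt A (q t) t) (hAtop : Tendsto A atTop atTop)
    (hr0 : ∀ᶠ t in atTop, 0 ≤ r t) (hr : ∀ ε > 0, ∀ᶠ t in atTop, r t ^ 2 ≤ ε * q t ^ 2) :
    Tendsto x atTop (𝓝 0) ∧ Tendsto z atTop (𝓝 0) := by
  have key := consensus_tendsto_zero (V := V) hN hRr hRR hL₁ hL₂ hP₃ hP hΦ₂
    (x := fun t => WithLp.toLp 2 (x t)) (z := fun t => WithLp.toLp 2 (z t))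
    (h := fun t => WithLp.toLp 2 (h t)) (D := fun t => WithLp.toLp 2 (D t))
    (e := fun t => WithLp.toLp 2 (e t)) (M := M) (C := Fintype.card (Fin N) * C) ha hm
    (hx.mono fun t ht => hasDerivAt_toLp ht) (hz.mono fun t ht => hasDerivAt_toLp ht)
    ?_ ?_ ?_ ?_ ?_ hσ hq0 hq hA hAtop hr
  · have hc : Continuous (WithLp.ofLp : PiLp 2 (fun _ : Fin N => V) → Fin N → V) :=
      PiLp.continuous_ofLp 2 _
    exact ⟨(hc.tendsto 0).comp key.1, (hc.tendsto 0).comp key.2⟩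
  · filter_upwards [hzr] with t ht
    ext i : 1
    simp [vecMulVec_apply, rVec, ← Finset.smul_sum, ht]
  · filter_upwards [hhn, hq0] with t h1 h2
    exact norm_le_mul_norm_of_forall (by positivity) h1
  · filter_upwards [hhx] with t ht
    rw [PiLp.norm_sq_eq_of_L2, PiLp.inner_apply, Finset.mul_sum]
    exact Finset.sum_le_sum fun i _ => ht i
  · filter_upwards [hD, hr0] with t h1 h2
    rw [mul_assoc]
    exact norm_le_card_mul_of_forall (by positivity) h1
  · filter_upwards [he, hr0] with t h1 h2
    rw [mul_assoc]
    exact norm_le_card_mul_of_forall (by positivity) h1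

end Consensus

/-- A stable scalar linear equation with vanishing perturbations. -/
lemma tendsto_zero_of_stable_linear {η σ g : ℝ → ℝ} {ω : ℝ} (hω : 0 < ω)
    (hη : ∀ᶠ t in atTop, HasDerivAt η ((σ t - ω) * η t + g t) t)
    (hσ : Tendsto σ atTop (𝓝 0)) (hg : Tendsto g atTop (𝓝 0)) : Tendsto η atTop (𝓝 0) := by
  have hV : Tendsto (fun t => η t ^ 2) atTop (𝓝 0) := by
    refine tendsto_zero_of_deriv_le
      (V' := fun t => 2 * η t * ((σ t - ω) * η t + g t)) (A := fun t => ω * t)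
      (a := fun _ => ω) (b := fun t => 2 / ω * g t ^ 2) ?_
      (Eventually.of_forall fun t => sq_nonneg _) ?_ (tendsto_id.const_mul_atTop hω) ?_ ?_
    · filter_upwards [hη] with t ht
      exact (ht.pow 2).congr_deriv (by simp)
    · exact Eventually.of_forall fun t => by simpa using (hasDerivAt_id t).const_mul ω
    -- Once `σ ≤ ω/4`, the term `-2(ω - σ) η²` leaves room for Young's inequality on `2 η g` and
    -- still gives rate `ω`.
    · filter_upwards [hσ.eventually_le_const (show 0 < ω / 4 by positivity)] with t ht
      have h1 : 0 ≤ ω / 2 * (η t - 2 * g t / ω) ^ 2 := by positivity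
      have e : ω / 2 * (η t - 2 * g t / ω) ^ 2
          = ω / 2 * η t ^ 2 + 2 / ω * g t ^ 2 - 2 * η t * g t := by
        field_simp
        ring
      have h2 := mul_le_mul_of_nonneg_right ht (sq_nonneg (η t))
      linarith
    · intro ε hε
      have h1 := (hg.pow 2).const_mul (2 / ω)
      simp only [ne_eq, OfNat.ofNat_ne_zero, not_false_eq_true, zero_pow, mul_zero] at h1
      exact h1.eventually_le_const (by positivity)
  exact tendsto_zero_of_mul_sq_le one_pos hV fun t => by simp

/-! ### The growth function `ξ` -/

section Growth

variable {p : Params} {t₀ : ℝ}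

lemma one_le_base (p : Params) {t : ℝ} (ht : t₀ ≤ t) : 1 ≤ 1 + p.β * (t - t₀) :=
  le_add_of_nonneg_right (mul_nonneg p.β_pos.le (sub_nonneg.2 ht))

lemma one_le_xi (p : Params) {t : ℝ} (ht : t₀ ≤ t) : 1 ≤ xi p t₀ t :=
  Real.one_le_rpow (one_le_base p ht) (one_div_nonneg.2 p.v_pos.le)

lemma xi_pos (p : Params) {t : ℝ} (ht : t₀ ≤ t) : 0 < xi p t₀ t :=
  one_pos.trans_le (one_le_xi p ht)

lemma tendsto_base (p : Params) (t₀ : ℝ) :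
    Tendsto (fun t => 1 + p.β * (t - t₀)) atTop atTop :=
  tendsto_atTop_add_const_left _ _
    ((tendsto_atTop_add_const_right _ (-t₀) tendsto_id).const_mul_atTop p.β_pos)

lemma tendsto_xi (p : Params) (t₀ : ℝ) : Tendsto (xi p t₀) atTop atTop :=
  (tendsto_rpow_atTop (one_div_pos.2 p.v_pos)).comp (tendsto_base p t₀)

lemma tendsto_xi_rpow (p : Params) (t₀ : ℝ) {s : ℝ} (hs : s < 0) :
    Tendsto (fun t => xi p t₀ t ^ s) atTop (𝓝 0) := by
  have := (tendsto_rpow_neg_atTop (neg_pos.2 hs)).comp (tendsto_xi p t₀)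
  simpa [Function.comp_def] using this

/-- An antiderivative of `ξ⁻¹`. -/
def xiInvPrimitive (p : Params) (t₀ t : ℝ) : ℝ :=
  (p.β * (1 - 1 / p.v))⁻¹ * (1 + p.β * (t - t₀)) ^ (1 - 1 / p.v)

lemma hasDerivAt_xiInvPrimitive (hv : 1 < p.v) {t : ℝ} (ht : t₀ ≤ t) :
    HasDerivAt (xiInvPrimitive p t₀) (xi p t₀ t)⁻¹ t := by
  have hb : 0 < 1 + p.β * (t - t₀) := one_pos.trans_le (one_le_base p ht)
  have h1 : HasDerivAt (fun t => 1 + p.β * (t - t₀)) p.β t := by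
    simpa using (((hasDerivAt_id t).sub_const t₀).const_mul p.β).const_add 1
  have hs : 1 - 1 / p.v ≠ 0 := by
    have : 1 / p.v < 1 := by rwa [div_lt_one p.v_pos]
    linarith
  refine ((h1.rpow_const (p := 1 - 1 / p.v) (Or.inl hb.ne')).const_mul
    (p.β * (1 - 1 / p.v))⁻¹).congr_deriv ?_
  have e : 1 - 1 / p.v - 1 = -(1 / p.v) := by ring
  rw [e, Real.rpow_neg hb.le, xi]
  have := p.β_pos.ne'
  generalize 1 - 1 / p.v = s at hs
  field_simp

/-- The damping rate `ξ⁻¹` is not integrable, since `1 - 1/v > 0`. -/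
lemma tendsto_xiInvPrimitive (hv : 1 < p.v) : Tendsto (xiInvPrimitive p t₀) atTop atTop := by
  have hs : 0 < 1 - 1 / p.v := by
    have : 1 / p.v < 1 := by rwa [div_lt_one p.v_pos]
    linarith
  exact ((tendsto_rpow_atTop hs).comp (tendsto_base p t₀)).const_mul_atTop
    (inv_pos.2 (mul_pos p.β_pos hs))

end Growth

/-! ### Estimates along solutions -/

section Solution

variable {N d l : ℕ} {p : Params} {t₀ c : ℝ} {G : Digraph (Fin N)}
  {f : Fin N → Vec d → Vec l → ℝ} {ζ : ℝ → Vec l} {mᵢ Mᵢ : Fin N → ℝ} {xs : ℝ → Vec d}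
  {xloc : Fin N → ℝ → Vec d} {x : ℝ → Stack N d} {η : ℝ → Fin N → ℝ} {z : ℝ → Stack N d}

lemma xBar_sub (x : Stack N d) (t : ℝ) (i : Fin N) :
    xBar p t₀ xs x t i - xs t = (xi p t₀ t)⁻¹ • x i := by
  simp [xBar]

lemma GrowthAssumption.norm_le (h : GrowthAssumption t₀ (xi p t₀) c ζ xs xloc) :
    ∃ ρ, ∀ t, t₀ ≤ t → ‖xs t‖ ≤ ρ ∧ ‖ζ t‖ ≤ ρ := by
  obtain ⟨ρ, -, hρ⟩ := h.bound
  refine ⟨ρ, fun t ht => ?_⟩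
  have h1 := hρ t ht
  have h2 : 0 ≤ ∑ i, ‖xloc i t‖ := Finset.sum_nonneg fun i _ => norm_nonneg _
  constructor <;> linarith [norm_nonneg (xs t), norm_nonneg (ζ t)]

lemma GrowthAssumption.norm_deriv_le (h : GrowthAssumption t₀ (xi p t₀) c ζ xs xloc) :
    ∃ M₂, 0 ≤ M₂ ∧ ∀ t, t₀ ≤ t → ‖deriv xs t‖ + ‖deriv ζ t‖ ≤ M₂ * xi p t₀ t ^ c := by
  obtain ⟨M₂, hM₂, hle⟩ := h.growth
  refine ⟨M₂, hM₂, fun t ht => ?_⟩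
  linarith [hle t ht, norm_nonneg (deriv (deriv ζ) t), norm_nonneg (deriv (deriv xs) t)]

/-- Derivatives along the optimal trajectory decay like `ξ ^ c`. -/
lemma exists_norm_deriv_trajectory_le {U : Type*} [NormedAddCommGroup U] [NormedSpace ℝ U]
    (h : GrowthAssumption t₀ (xi p t₀) c ζ xs xloc) (hxs : Differentiable ℝ xs)
    {g : Fin N → Vec d × Vec l → U} (hg : ∀ i, ContDiff ℝ 1 (g i)) :
    ∃ C, 0 ≤ C ∧ ∀ i t, t₀ ≤ t →
      ‖deriv (fun s => g i (xs s, ζ s)) t‖ ≤ C * xi p t₀ t ^ c := by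
  obtain ⟨ρ, hρ⟩ := h.norm_le
  obtain ⟨M₂, hM₂, hle⟩ := h.norm_deriv_le
  choose C hC0 hC using fun i => exists_norm_deriv_comp_le (hg i) hxs h.diff hρ
  refine ⟨(∑ i, C i) * M₂, mul_nonneg (Finset.sum_nonneg fun i _ => hC0 i) hM₂, fun i t ht => ?_⟩
  rw [mul_assoc]
  exact (hC i t ht).trans (mul_le_mul
    (Finset.single_le_sum (fun i _ => hC0 i) (Finset.mem_univ i)) (hle t ht) (by positivity)
    (Finset.sum_nonneg fun i _ => hC0 i))

lemma differentiable_zStar (hcost : CostAssumption f ζ mᵢ Mᵢ) (hζ : Differentiable ℝ ζ)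
    (hxs : Differentiable ℝ xs) (i : Fin N) :
    Differentiable ℝ fun s => zStar p f ζ xs s i :=
  ((((hcost.contDiff_gradX i).differentiable two_ne_zero).comp (hxs.prodMk hζ)).const_smul
    (1 / 2 * p.α * p.k)).neg

lemma sum_zStar_eq_zero (hcost : CostAssumption f ζ mᵢ Mᵢ) (hopt : IsOptimum f ζ xs) (t : ℝ) :
    ∑ i, zStar p f ζ xs t i = 0 := by
  simp only [zStar, Finset.sum_neg_distrib, ← Finset.smul_sum, sum_gradX_eq_zero hcost hopt t,
    smul_zero, neg_zero]

lemma sum_lapAct_eq_zero (hG : GraphAssumption G) (x : Stack N d) : ∑ i, lapAct G x i = 0 := by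
  have h := const_vecMul_laplacian hG 1
  simp only [lapAct]
  rw [Finset.sum_comm]
  refine Finset.sum_eq_zero fun j _ => ?_
  rw [← Finset.sum_smul]
  have := congrFun h j
  simp only [vecMul, dotProduct, one_mul, Pi.zero_apply] at this
  rw [this, zero_smul]

/-- The sum of the `z`-components is conserved. -/
lemma sum_z_eq_zero (hcost : CostAssumption f ζ mᵢ Mᵢ) (hopt : IsOptimum f ζ xs)
    (hζ : Differentiable ℝ ζ) (hxs : Differentiable ℝ xs) (hG : GraphAssumption G)
    (hsol : IsAveragedSolution p t₀ G f ζ xs x η z) (hinit : ∑ i, z t₀ i = 0) {t : ℝ}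
    (ht : t₀ ≤ t) : ∑ i, z t i = 0 := by
  have hder : ∀ s, t₀ ≤ s → HasDerivWithinAt (fun s => ∑ i, z s i) 0 (Set.Ici t₀) s := by
    intro s hs
    have h1 : HasDerivWithinAt (fun s => ∑ i, z s i) (∑ i, rhsZ p G f ζ xs s (x s) i)
        (Set.Ici t₀) s :=
      HasDerivWithinAt.fun_sum fun i _ => (hasDerivWithinAt_pi.1 (hsol.z_eq s hs)) i
    have h2 : ∑ i, deriv (fun s => zStar p f ζ xs s i) s = 0 := by
      -- Optimality of `x*` makes `∑ z*_i` vanish identically, so its derivative does too.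
      rw [← deriv_fun_sum fun i _ => differentiable_zStar hcost hζ hxs i s]
      simp only [sum_zStar_eq_zero hcost hopt, deriv_const]
    have h3 : ∑ i, rhsZ p G f ζ xs s (x s) i = 0 := by
      simp only [rhsZ, Finset.sum_sub_distrib, ← Finset.smul_sum, sum_lapAct_eq_zero hG, h2,
        smul_zero, sub_zero]
    rwa [h3] at h1
  rw [constant_of_has_deriv_right_zero (a := t₀) (b := t)
    (fun s hs => ((hder s hs.1).continuousWithinAt).mono Set.Icc_subset_Ici_self)
    (fun s hs => (hder s hs.1).mono (Set.Ici_subset_Ici.2 hs.1)) t ⟨ht, le_rfl⟩, hinit]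

/-- Fits the averaged system to `consensus_tendsto_zero_pi`. The shift `z*` turns the gradient into
the difference `∇f_i(x̄_i) - ∇f_i(x*)`, monotone of order `ξ⁻¹` because `x̄_i - x* = ξ⁻¹ x_i`. -/
theorem tendsto_x_z (hN : 0 < N) (hcost : CostAssumption f ζ mᵢ Mᵢ) (hopt : IsOptimum f ζ xs)
    (hgrowth : GrowthAssumption t₀ (xi p t₀) c ζ xs xloc) (hxs : Differentiable ℝ xs)
    (hG : GraphAssumption G) {R : Matrix (Fin N) (Fin (N - 1)) ℝ}
    (hRr : Rᵀ *ᵥ rVec N = 0) (hRR : Rᵀ * R = 1) (hv : 2 ≤ p.v) (hc : c < -3)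
    {P₂ P₃ : Matrix (Fin (N - 1)) (Fin (N - 1)) ℝ} {p₁₁ p₂₂ δ : ℝ} (hP₃ : P₃.PosDef)
    (hP : (lyapBlock p₂₂ P₂ P₃).PosDef)
    (hΦ₂ : NegDef (Phi2 p p₁₁ p₂₂ δ (Rᵀ * laplacian G * R) P₂ P₃))
    (hsol : IsAveragedSolution p t₀ G f ζ xs x η z) (hinit : ∑ i, z t₀ i = 0) :
    Tendsto x atTop (𝓝 0) ∧ Tendsto z atTop (𝓝 0) := by
  have hne : Nonempty (Fin N) := ⟨⟨0, hN⟩⟩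
  obtain ⟨i₀, hi₀⟩ := Finite.exists_min mᵢ
  obtain ⟨M₂, hM₂, hle⟩ := hgrowth.norm_deriv_le
  have hzC : ∃ C, 0 ≤ C ∧ ∀ i t, t₀ ≤ t →
      ‖deriv (fun s => zStar p f ζ xs s i) t‖ ≤ C * xi p t₀ t ^ c :=
    exists_norm_deriv_trajectory_le hgrowth hxs
      (g := fun i y => -((1 / 2 * p.α * p.k) • gradX f i y.1 y.2)) fun i =>
        ((((hcost.contDiff_gradX i).of_le one_le_two).const_smul _).neg)
  obtain ⟨C, hC0, hC⟩ := hzC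
  have hrdef : ∀ t, t₀ ≤ t →
      (xi p t₀ t)⁻¹ * xi p t₀ t ^ (c + 2) = xi p t₀ t * xi p t₀ t ^ c := fun t ht => by
    have hξ := xi_pos p ht
    rw [Real.rpow_add hξ, Real.rpow_two]
    field_simp
  have hrle : ∀ t, t₀ ≤ t → xi p t₀ t ^ c ≤ (xi p t₀ t)⁻¹ * xi p t₀ t ^ (c + 2) := fun t ht => by
    rw [hrdef t ht]
    exact le_mul_of_one_le_left (Real.rpow_nonneg (xi_pos p ht).le _) (one_le_xi p ht)
  refine consensus_tendsto_zero_pi (V := Vec d) hN hRr hRR (laplacian_mulVec_const G _)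
    (const_vecMul_laplacian hG _) hP₃ hP hΦ₂
    (h := fun t i => gradX f i (xBar p t₀ xs (x t) t i) (ζ t) - gradX f i (xs t) (ζ t))
    (D := fun t _ => xi p t₀ t • deriv xs t)
    (e := fun t i => deriv (fun s => zStar p f ζ xs s i) t)
    (σ := fun t => p.β / p.v * xi p t₀ t ^ (-p.v))
    -- `r` is `ξ^(1+c)`, the size of `ξ ẋ*`, factored so that `r/q = ξ^(c+2) → 0` is visible.
    (q := fun t => (xi p t₀ t)⁻¹) (r := fun t => (xi p t₀ t)⁻¹ * xi p t₀ t ^ (c + 2))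
    (A := xiInvPrimitive p t₀) (a := 1 / 2 * p.α * p.k) (m := mᵢ i₀) (M := ∑ i, |Mᵢ i|)
    (C := M₂ + C) (S := p.β / p.v)
    (by have := p.α_pos; have := p.k_pos; positivity) (hcost.pos i₀)
    (Finset.sum_nonneg fun i _ => abs_nonneg _) (add_nonneg hM₂ hC0)
    ?_ ?_ ?_ ?_ ?_ ?_ ?_ ?_ ?_ ?_ ?_ (tendsto_xiInvPrimitive (by linarith)) ?_ ?_
  · filter_upwards [eventually_gt_atTop t₀] with t ht
    refine ((hsol.x_eq t ht.le).hasDerivAt (Ici_mem_nhds ht)).congr_deriv ?_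
    funext i
    simp only [rhsX, zStar, lapAct, smul_sub]
    abel
  · filter_upwards [eventually_gt_atTop t₀] with t ht
    exact (hsol.z_eq t ht.le).hasDerivAt (Ici_mem_nhds ht)
  · filter_upwards [eventually_ge_atTop t₀] with t ht
    exact sum_z_eq_zero hcost hopt hgrowth.diff hxs hG hsol hinit ht
  · filter_upwards [eventually_ge_atTop t₀] with t ht i
    have hξ := xi_pos p ht
    have h1 := hcost.lipschitz i t (xBar p t₀ xs (x t) t i) (xs t)
    rw [xBar_sub, norm_smul, norm_inv, Real.norm_eq_abs, abs_of_pos hξ] at h1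
    refine h1.trans ?_
    rw [mul_assoc]
    refine mul_le_mul_of_nonneg_right ((le_abs_self _).trans ?_) (by positivity)
    exact Finset.single_le_sum (f := fun i => |Mᵢ i|) (fun i _ => abs_nonneg _)
      (Finset.mem_univ i)
  · filter_upwards [eventually_ge_atTop t₀] with t ht i
    have hξ := xi_pos p ht
    have h1 := hcost.strongMono i t (xBar p t₀ xs (x t) t i) (xs t)
    rw [xBar_sub, norm_smul, norm_inv, Real.norm_eq_abs, abs_of_pos hξ, inner_smul_right] at h1
    have h2 := mul_le_mul_of_nonneg_left h1 hξ.le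
    rw [mul_inv_cancel_left₀ hξ.ne'] at h2
    have h3 : xi p t₀ t * (mᵢ i * ((xi p t₀ t)⁻¹ * ‖x t i‖) ^ 2)
        = mᵢ i * (xi p t₀ t)⁻¹ * ‖x t i‖ ^ 2 := by
      field_simp
    rw [h3] at h2
    exact (mul_le_mul_of_nonneg_right (mul_le_mul_of_nonneg_right (hi₀ i)
      (inv_nonneg.2 hξ.le)) (sq_nonneg _)).trans h2
  · filter_upwards [eventually_ge_atTop t₀] with t ht i
    have hξ := xi_pos p ht
    rw [norm_smul, Real.norm_eq_abs, abs_of_pos hξ, hrdef t ht]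
    have h1 : ‖deriv xs t‖ ≤ (M₂ + C) * xi p t₀ t ^ c := by
      have h2 := hle t ht
      have h3 : 0 ≤ C * xi p t₀ t ^ c := by positivity
      linarith [norm_nonneg (deriv ζ t)]
    have := mul_le_mul_of_nonneg_left h1 hξ.le
    linarith
  · filter_upwards [eventually_ge_atTop t₀] with t ht i
    have hξ := xi_pos p ht
    refine (hC i t ht).trans (mul_le_mul (by linarith) (hrle t ht) (by positivity)
      (by linarith))
  · filter_upwards [eventually_ge_atTop t₀] with t ht
    have hξ := xi_pos p ht
    have := p.β_pos
    have := p.v_pos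
    rw [abs_of_nonneg (by positivity)]
    refine mul_le_mul_of_nonneg_left ?_ (by positivity)
    rw [inv_pow, ← Real.rpow_two, ← Real.rpow_neg hξ.le]
    exact Real.rpow_le_rpow_of_exponent_le (one_le_xi p ht) (by linarith)
  · filter_upwards [eventually_ge_atTop t₀] with t ht using inv_pos.2 (xi_pos p ht)
  · exact (tendsto_xi p t₀).inv_tendsto_atTop
  · filter_upwards [eventually_ge_atTop t₀] with t ht
    exact hasDerivAt_xiInvPrimitive (by linarith) ht
  · filter_upwards [eventually_ge_atTop t₀] with t ht
    have hξ := xi_pos p ht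
    positivity
  · intro ε hε
    have h1 := (tendsto_xi_rpow p t₀ (s := c + 2) (by linarith)).pow 2
    rw [zero_pow two_ne_zero] at h1
    filter_upwards [h1.eventually_le_const hε] with t ht
    rw [mul_pow, mul_comm]
    exact mul_le_mul_of_nonneg_right ht (sq_nonneg _)

/-- The factor `ξ` in the input cancels against `x̄_i - x* = ξ⁻¹ x_i`, leaving `O(‖x_i‖)`; the drift
of `f_i` along `x*` contributes `ξ^(1+c) → 0`. -/
theorem tendsto_eta (hcost : CostAssumption f ζ mᵢ Mᵢ)
    (hgrowth : GrowthAssumption t₀ (xi p t₀) c ζ xs xloc) (hxs : Differentiable ℝ xs)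
    (hc : c < -3) (hsol : IsAveragedSolution p t₀ G f ζ xs x η z)
    (hx : Tendsto x atTop (𝓝 0)) : Tendsto η atTop (𝓝 0) := by
  have hf1 : ∀ i, ContDiff ℝ 1 fun y : Vec d × Vec l => f i y.1 y.2 := fun i =>
    (hcost.smooth i).of_le (by norm_num)
  obtain ⟨ρ, hρ⟩ := hgrowth.norm_le
  obtain ⟨C, hC0, hC⟩ := exists_norm_deriv_trajectory_le hgrowth hxs hf1
  refine tendsto_pi_nhds.2 fun i => ?_
  have hxi : Tendsto (fun t => ‖x t i‖) atTop (𝓝 0) :=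
    tendsto_zero_iff_norm_tendsto_zero.1 (tendsto_pi_nhds.1 hx i)
  -- Radius `ρ + 1` also contains `x̄_i` once `‖x_i‖ ≤ 1`, since `ξ⁻¹ ≤ 1`.
  obtain ⟨K, hK0, hK⟩ := exists_lipschitz_fst (hf1 i) (ρ + 1)
  refine tendsto_zero_of_stable_linear p.ωh_pos
    (σ := fun t => p.β / p.v * xi p t₀ t ^ (-p.v))
    (g := fun t => p.ωh * (xi p t₀ t * hf p t₀ f ζ xs (x t) t i)
      - xi p t₀ t * deriv (fun s => f i (xs s) (ζ s)) t) ?_ ?_ ?_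
  · filter_upwards [eventually_gt_atTop t₀] with t ht
    refine (hasDerivAt_pi.1 ((hsol.eta_eq t ht.le).hasDerivAt (Ici_mem_nhds ht)) i).congr_deriv ?_
    simp only [rhsEta]
    ring
  · simpa using (tendsto_xi_rpow p t₀ (neg_neg_of_pos p.v_pos)).const_mul (p.β / p.v)
  · have h1 : Tendsto (fun t => xi p t₀ t * hf p t₀ f ζ xs (x t) t i) atTop (𝓝 0) := by
      refine squeeze_zero_norm' ?_ (by simpa using hxi.const_mul K)
      filter_upwards [eventually_ge_atTop t₀, hxi.eventually_le_const one_pos] with t ht hx1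
      have hξ := xi_pos p ht
      have hq : (xi p t₀ t)⁻¹ ≤ 1 := inv_le_one_of_one_le₀ (one_le_xi p ht)
      have h2 : ‖xBar p t₀ xs (x t) t i - xs t‖ = (xi p t₀ t)⁻¹ * ‖x t i‖ := by
        rw [xBar_sub, norm_smul, norm_inv, Real.norm_eq_abs, abs_of_pos hξ]
      have h3 : ‖xBar p t₀ xs (x t) t i‖ ≤ ρ + 1 := by
        have h4 : (xi p t₀ t)⁻¹ * ‖x t i‖ ≤ 1 :=
          mul_le_one₀ hq (norm_nonneg _) hx1
        have h5 := norm_add_le (xs t) (xBar p t₀ xs (x t) t i - xs t)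
        rw [add_sub_cancel, h2] at h5
        linarith [(hρ t ht).1]
      have h6 := hK _ (xs t) (ζ t) h3 ((hρ t ht).1.trans (by linarith))
        ((hρ t ht).2.trans (by linarith))
      rw [h2] at h6
      rw [norm_mul, Real.norm_eq_abs, abs_of_pos hξ]
      have h7 := mul_le_mul_of_nonneg_left h6 hξ.le
      refine h7.trans_eq ?_
      field_simp
    have h2 : Tendsto (fun t => xi p t₀ t * deriv (fun s => f i (xs s) (ζ s)) t) atTop (𝓝 0) := by
      have h3 := (tendsto_xi_rpow p t₀ (s := 1 + c) (by linarith)).const_mul C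
      rw [mul_zero] at h3
      refine squeeze_zero_norm' ?_ h3
      filter_upwards [eventually_ge_atTop t₀] with t ht
      have hξ := xi_pos p ht
      rw [norm_mul, Real.norm_eq_abs, abs_of_pos hξ, Real.rpow_add hξ, Real.rpow_one]
      have := mul_le_mul_of_nonneg_left (hC i t ht) hξ.le
      linarith
    simpa using (h1.const_mul p.ωh).sub h2

end Solution

end TVOpt

end

/-! ### Convergence of the averaged system. -/

theorem mainTheorem3 {N d l : ℕ} (p : TVOpt.Params) (t₀ c : ℝ)
    (G : Digraph (Fin N)) (f : Fin N → TVOpt.Vec d → TVOpt.Vec l → ℝ) (ζ : ℝ → TVOpt.Vec l)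
    (mᵢ Mᵢ : Fin N → ℝ) (xs : ℝ → TVOpt.Vec d) (xloc : Fin N → ℝ → TVOpt.Vec d)
    (hcost : TVOpt.CostAssumption f ζ mᵢ Mᵢ)
    (hxs : TVOpt.IsOptimum f ζ xs) (hxloc : TVOpt.IsLocalOptimum f ζ xloc)
    (hgrowth : TVOpt.GrowthAssumption t₀ (TVOpt.xi p t₀) c ζ xs xloc)
    (hgraph : TVOpt.GraphAssumption G)
    (R : Matrix (Fin N) (Fin (N - 1)) ℝ)
    (hRr : Matrix.mulVec Rᵀ (TVOpt.rVec N) = 0) (hRR : Rᵀ * R = 1)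
    (hv : 2 ≤ p.v) (hc : c < -3)
    (P₂ P₃ : Matrix (Fin (N - 1)) (Fin (N - 1)) ℝ) (p₁₁ p₂₂ δ : ℝ)
    (hP₃ : P₃.PosDef) (hp₁₁ : 0 < p₁₁) (hp₂₂ : 0 < p₂₂) (hδ : 0 < δ)
    (hP : (TVOpt.lyapBlock p₂₂ P₂ P₃).PosDef)
    (hΦ₁ : TVOpt.NegDef (TVOpt.Phi1 p (⨅ i, mᵢ i) (⨆ i, Mᵢ i) p₁₁ p₂₂ δ P₂))
    (hΦ₂ : TVOpt.NegDef
      (TVOpt.Phi2 p p₁₁ p₂₂ δ (Rᵀ * TVOpt.laplacian G * R) P₂ P₃))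
    (x : ℝ → TVOpt.Stack N d) (η : ℝ → Fin N → ℝ) (z : ℝ → TVOpt.Stack N d)
    (hsol : TVOpt.IsAveragedSolution p t₀ G f ζ xs x η z)
    (hinit : (x t₀, η t₀, z t₀) ∈ TVOpt.Omega N (0 : TVOpt.Vec d)) :
    Tendsto (fun t => (x t, η t, z t)) atTop (𝓝 0) := by
  -- With no agents the state space is a single point.
  rcases Nat.eq_zero_or_pos N with rfl | hN
  · have : (fun t => (x t, η t, z t)) = fun _ => 0 := by
      funext t
      exact Subsingleton.elim _ _
    rw [this]
    exact tendsto_const_nhds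
  · have hdiff := TVOpt.differentiable_optimum hcost hxs hgrowth.diff hN
    obtain ⟨hx, hz⟩ := TVOpt.tendsto_x_z hN hcost hxs hgrowth hdiff hgraph hRr hRR hv hc hP₃ hP
      hΦ₂ hsol hinit
    exact hx.prodMk_nhds ((TVOpt.tendsto_eta hcost hgrowth hdiff hc hsol hx).prodMk_nhds hz)
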